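/- Let $\mathsf{A}$ be an abelian category with a torsion theory $(\mathcal{T},\mathcal{F})$: a pair of full subcategories, closed under isomorphism, such that $\operatorname{Hom}(T,F)=0$ for $T\in\mathcal{T}$, $F\in\mathcal{F}$, and every $A\in\mathsf{A}$ sits in a short exact sequence $0\to T\to A\to F\to 0$ with $T\in\mathcal{T}$, $F\in\mathcal{F}$. Let $\mathsf{B}$ be the following (abelian) category. Its objects are the morphisms $\mathbb{X}=[X^{-1}\xrightarrow{d}X^0]$ of $\mathsf{A}$ with $\ker d\in\mathcal{F}$ and $\operatorname{coker} d\in\mathcal{T}$. A morphism $\mathbb{X}\to\mathbb{Y}$ is an isomorphism class of diagrams $(E,\kappa,\iota,\sigma,\rho)$ with $\kappa\colon X^{-1}\to E$, $\iota\colon Y^{-1}\to E$, $\sigma\colon E\to X^0$, $\rho\colon E\to Y^0$, such that $\sigma\kappa=d$, $\rho\iota=d$, $\rho\kappa=0$, and $0\to Y^{-1}\xrightarrow{\iota}E\xrightarrow{\sigma}X^0\to 0$ is exact. The composite of $(E,\kappa,\iota,\sigma,\rho)\colon\mathbb{X}\to\mathbb{Y}$ with $(F,\kappa',\iota',\sigma',\rho')\colon\mathbb{Y}\to\mathbb{Z}$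 is carried by $\operatorname{coker}\big((\iota,\kappa')\colon Y^{-1}\to E\times_{Y^0}F\big)$, with the maps induced by $(\kappa,0)$, $(0,\iota')$, $\sigma$ and $\rho'$. A morphism is strict if it comes from a morphism of complexes $(f^{-1},f^0)\colon\mathbb{X}\to\mathbb{Y}$, that is, if it is the class of $E=X^0\oplus Y^{-1}$ with $\kappa=(d,-f^{-1})$, $\iota=\mathrm{in}_2$, $\sigma=\mathrm{pr}_1$, $\rho=f^0+d$. Let $\mathsf{Ch}(\mathsf{B})$ be the category of (unbounded) complexes in $\mathsf{B}$, let $\mathcal{D}(\mathsf{B})$ be the derived category of $\mathsf{B}$, and let $\mathsf{Ch}^{st}(\mathsf{B})\subset\mathsf{Ch}(\mathsf{B})$ be the subcategory with the same objects and with the morphisms of complexes all of whose components are strict. Let $\mathcal{S}_{sis}$ be the class of morphisms of $\mathsf{Ch}^{st}(\mathsf{B})$ that become isomorphisms in $\mathsf{Ch}(\mathsf{B})$, and $\mathcal{S}_{qis}$ the class of morphisms of $\mathsf{Ch}^{st}(\mathsf{B})$ that are quasi-isomorphisms of complexes in $\mathsf{B}$. Then the inclusion $\mathsf{Ch}^{st}(\mathsf{B})\hookrightarrow\mathsf{Ch}(\mathsf{B})$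 induces equivalences of categories $$\mathcal{S}_{sis}^{-1}\mathsf{Ch}^{st}(\mathsf{B})\xrightarrow{\ \sim\ }\mathsf{Ch}(\mathsf{B}),\qquad \mathcal{S}_{qis}^{-1}\mathsf{Ch}^{st}(\mathsf{B})\xrightarrow{\ \sim\ }\mathcal{D}(\mathsf{B}).$$ -/

import Mathlib

open CategoryTheory CategoryTheory.Limits

universe w v u

/-- A torsion theory (torsion pair) `(T, F)` in an abelian category. Both subcategories are
full and closed under isomorphisms; closure under finite direct sums follows. -/
structure TorsionPair (A : Type u) [Category.{v} A] [Abelian A] where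
  T : ObjectProperty A
  F : ObjectProperty A
  isoT : T.IsClosedUnderIsomorphisms
  isoF : F.IsClosedUnderIsomorphisms
  hom_eq_zero : ∀ ⦃X Y : A⦄, T X → F Y → ∀ f : X ⟶ Y, f = 0
  exists_shortExact : ∀ X : A, ∃ (X' X'' : A) (i : X' ⟶ X) (p : X ⟶ X'') (w : i ≫ p = 0),
    T X' ∧ F X'' ∧ (ShortComplex.mk i p w).ShortExact

namespace TorsionPair

variable {A : Type u} [Category.{v} A] [Abelian A]

attribute [local simp] pullback.lift_fst pullback.lift_fst_assoc pullback.lift_snd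
  pullback.lift_snd_assoc pushout.inl_desc pushout.inl_desc_assoc pushout.inr_desc
  pushout.inr_desc_assoc

section Torsion

variable (t : TorsionPair A)

lemma T_of_hom {X : A} (h : ∀ ⦃Y : A⦄, t.F Y → ∀ g : X ⟶ Y, g = 0) : t.T X := by
  obtain ⟨X', X'', i, p, w, h1, h2, h3⟩ := t.exists_shortExact X
  have := t.isoT
  have := h3.mono_f
  have := h3.epi_g
  dsimp at *
  have hp : p = 0 := h h2 p
  have : Epi i := h3.exact.epi_f hp
  have : IsIso i := isIso_of_mono_of_epi i
  exact t.T.prop_of_iso (asIso i) h1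

lemma F_of_hom {X : A} (h : ∀ ⦃Y : A⦄, t.T Y → ∀ g : Y ⟶ X, g = 0) : t.F X := by
  obtain ⟨X', X'', i, p, w, h1, h2, h3⟩ := t.exists_shortExact X
  have := t.isoF
  have := h3.mono_f
  have := h3.epi_g
  dsimp at *
  have hi : i = 0 := h h1 i
  have : Mono p := h3.exact.mono_g hi
  have : IsIso p := isIso_of_mono_of_epi p
  exact t.F.prop_of_iso (asIso p).symm h2

lemma T_cokernel_iff {X Y : A} (f : X ⟶ Y) :
    t.T (cokernel f) ↔ ∀ ⦃Z : A⦄, t.F Z → ∀ g : Y ⟶ Z, f ≫ g = 0 → g = 0 := by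
  constructor
  · intro h Z hZ g hg
    rw [← cokernel.π_desc f g hg, t.hom_eq_zero h hZ (cokernel.desc f g hg), comp_zero]
  · intro h
    refine t.T_of_hom fun Y hY g => ?_
    rw [← cancel_epi (cokernel.π f), comp_zero]
    exact h hY _ (by simp)

lemma F_kernel_iff {X Y : A} (f : X ⟶ Y) :
    t.F (kernel f) ↔ ∀ ⦃Z : A⦄, t.T Z → ∀ g : Z ⟶ X, g ≫ f = 0 → g = 0 := by
  constructor
  · intro h Z hZ g hg
    rw [← kernel.lift_ι f g hg, t.hom_eq_zero hZ h (kernel.lift f g hg), zero_comp]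
  · intro h
    refine t.F_of_hom fun Y hY g => ?_
    rw [← cancel_mono (kernel.ι f), zero_comp]
    exact h hY _ (by simp)

/-- The torsion filtration of the middle homology of a complex `X ⟶ E ⟶ Y`. -/
lemma exists_torsion_factorization {X E Y : A} (κ : X ⟶ E) (ρ : E ⟶ Y) (h : κ ≫ ρ = 0) :
    ∃ (K Q : A) (κ' : X ⟶ K) (a : K ⟶ E) (b : E ⟶ Q) (r : Q ⟶ Y) (w : a ≫ b = 0),
      κ' ≫ a = κ ∧ b ≫ r = ρ ∧ (ShortComplex.mk a b w).ShortExact ∧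
      t.T (cokernel κ') ∧ t.F (kernel r) := by
  let k : X ⟶ kernel ρ := kernel.lift ρ κ h
  obtain ⟨T, F, i, p, w, hT, hF, hS⟩ := t.exists_shortExact (cokernel k)
  have := hS.mono_f
  have := hS.epi_g
  dsimp at *
  let q : kernel ρ ⟶ F := cokernel.π k ≫ p
  let κ' : X ⟶ kernel q := kernel.lift q k (by simp [q])
  let a : kernel q ⟶ E := kernel.ι q ≫ kernel.ι ρ
  let b : E ⟶ pushout (kernel.ι ρ) q := pushout.inl _ _
  let f : F ⟶ pushout (kernel.ι ρ) q := pushout.inr _ _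
  have hbf : kernel.ι ρ ≫ b = q ≫ f := pushout.condition
  let r : pushout (kernel.ι ρ) q ⟶ Y := pushout.desc ρ 0 (by simp)
  have hbr : b ≫ r = ρ := pushout.inl_desc _ _ _
  have hfr : f ≫ r = 0 := pushout.inr_desc _ _ _
  have hab : a ≫ b = 0 := by simp [a, hbf]
  have : Mono f := inferInstance
  have : Epi b := inferInstance
  refine ⟨kernel q, pushout (kernel.ι ρ) q, κ', a, b, r, hab, by simp [κ', a, k], hbr, ?_, ?_, ?_⟩
  · refine { exact := ?_, mono_f := by dsimp; infer_instance, epi_g := by assumption }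
    rw [ShortComplex.exact_iff_exact_up_to_refinements]
    intro S x hx
    dsimp at x hx ⊢
    have hxρ : x ≫ ρ = 0 := by rw [← hbr, ← Category.assoc, hx, zero_comp]
    have hl : kernel.lift ρ x hxρ ≫ q = 0 := by
      rw [← cancel_mono f, Category.assoc, ← hbf, kernel.lift_ι_assoc, hx, zero_comp]
    exact ⟨S, 𝟙 S, inferInstance, kernel.lift q _ hl, by simp [a]⟩
  · rw [T_cokernel_iff]
    intro Z hZ g hg
    -- the torsion part of the cokernel is a quotient of `kernel q`
    have hq : (kernel.ι q ≫ cokernel.π k) ≫ p = 0 := by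
      rw [Category.assoc]; exact kernel.condition q
    let m : kernel q ⟶ T := hS.exact.lift _ hq
    have hm : m ≫ i = kernel.ι q ≫ cokernel.π k := hS.exact.lift_f _ hq
    have hem : Epi m := by
      rw [epi_iff_surjective_up_to_refinements]
      intro S y
      obtain ⟨S', π, hπ, x, hx⟩ := surjective_up_to_refinements_of_epi (cokernel.π k) (y ≫ i)
      have hxq : x ≫ q = 0 := by
        simp only [q]; rw [← Category.assoc, ← hx]; simp [w]
      refine ⟨S', π, hπ, kernel.lift q x hxq, ?_⟩
      rw [← cancel_mono i]
      simp [hm, hx]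
    have hker : kernel.ι m ≫ g = 0 := by
      have h1 : (kernel.ι m ≫ kernel.ι q) ≫ cokernel.π k = 0 := by
        rw [Category.assoc, ← hm, ← Category.assoc, kernel.condition, zero_comp]
      obtain ⟨S', π, hπ, x, hx⟩ :=
        (ShortComplex.exact_cokernel k).exact_up_to_refinements _ h1
      dsimp at x hx
      have h2 : π ≫ kernel.ι m = x ≫ κ' := by
        rw [← cancel_mono (kernel.ι q)]
        simpa [κ'] using hx
      rw [← cancel_epi π, ← Category.assoc, h2, Category.assoc, hg]
      simp
    rw [← Abelian.comp_epiDesc m g hker, t.hom_eq_zero hT hZ (Abelian.epiDesc m g hker), comp_zero]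
  · rw [F_kernel_iff]
    intro Z hZ g hg
    have hlift : ∃ m : Z ⟶ F, m ≫ f = g := by
      have hexact : (ShortComplex.mk f r hfr).Exact := by
        rw [ShortComplex.exact_iff_exact_up_to_refinements]
        intro S x hx
        dsimp at x hx ⊢
        obtain ⟨S', π, hπ, y, hy⟩ := surjective_up_to_refinements_of_epi b x
        have hyρ : y ≫ ρ = 0 := by
          rw [← hbr, ← Category.assoc, ← hy, Category.assoc, hx, comp_zero]
        refine ⟨S', π, hπ, kernel.lift ρ y hyρ ≫ q, ?_⟩
        rw [hy, Category.assoc, ← hbf, kernel.lift_ι_assoc]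
      exact ⟨hexact.lift g hg, hexact.lift_f g hg⟩
    obtain ⟨m, rfl⟩ := hlift
    rw [t.hom_eq_zero hZ hF m, zero_comp]

end Torsion

/-- The objects of the tilted category `B`: two-term complexes `d : X⁻¹ ⟶ X⁰` with
`ker d ∈ F` and `coker d ∈ T`. Here `X.neg` is `X⁻¹` and `X.zer` is `X⁰`. -/
structure Tilt (t : TorsionPair A) where
  neg : A
  zer : A
  d : neg ⟶ zer
  ker_mem : t.F (kernel d)
  coker_mem : t.T (cokernel d)

variable {t : TorsionPair A}

/-- The diagrams that represent the morphisms of `B`: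
`X⁻¹ ⟶ E ⟶ Y⁰` and `Y⁻¹ ⟶ E ⟶ X⁰`, the second of which is short exact. -/
structure Butterfly (X Y : t.Tilt) where
  E : A
  κ : X.neg ⟶ E
  ι : Y.neg ⟶ E
  σ : E ⟶ X.zer
  ρ : E ⟶ Y.zer
  κσ : κ ≫ σ = X.d
  ιρ : ι ≫ ρ = Y.d
  κρ : κ ≫ ρ = 0
  ισ : ι ≫ σ = 0
  shortExact : (ShortComplex.mk ι σ ισ).ShortExact

namespace Butterfly

/-- Two diagrams are identified if there is an isomorphism `E ≅ E'` commuting with the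
four arrows. -/
def Rel {X Y : t.Tilt} (P Q : Butterfly X Y) : Prop :=
  ∃ e : P.E ≅ Q.E, P.κ ≫ e.hom = Q.κ ∧ P.ι ≫ e.hom = Q.ι ∧ e.hom ≫ Q.σ = P.σ ∧ e.hom ≫ Q.ρ = P.ρ

section

variable {X Y : t.Tilt} (P Q : Butterfly X Y)

lemma κσ_assoc {Z : A} (h : X.zer ⟶ Z) : P.κ ≫ P.σ ≫ h = X.d ≫ h := by
  rw [← Category.assoc, P.κσ]

lemma ιρ_assoc {Z : A} (h : Y.zer ⟶ Z) : P.ι ≫ P.ρ ≫ h = Y.d ≫ h := by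
  rw [← Category.assoc, P.ιρ]

lemma κρ_assoc {Z : A} (h : Y.zer ⟶ Z) : P.κ ≫ P.ρ ≫ h = 0 := by
  rw [← Category.assoc, P.κρ, zero_comp]

lemma ισ_assoc {Z : A} (h : X.zer ⟶ Z) : P.ι ≫ P.σ ≫ h = 0 := by
  rw [← Category.assoc, P.ισ, zero_comp]

attribute [simp] κσ ιρ κρ ισ κσ_assoc ιρ_assoc κρ_assoc ισ_assoc

instance : Mono P.ι := P.shortExact.mono_f
instance : Epi P.σ := P.shortExact.epi_g

lemma exists_lift {S : A} (x : S ⟶ P.E) (hx : x ≫ P.σ = 0) : ∃ y : S ⟶ Y.neg, y ≫ P.ι = x :=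
  have : Mono (ShortComplex.mk P.ι P.σ P.ισ).f := P.shortExact.mono_f
  ⟨P.shortExact.exact.lift x hx, P.shortExact.exact.lift_f x hx⟩

lemma exists_desc {S : A} (x : P.E ⟶ S) (hx : P.ι ≫ x = 0) : ∃ y : X.zer ⟶ S, P.σ ≫ y = x :=
  have : Epi (ShortComplex.mk P.ι P.σ P.ισ).g := P.shortExact.epi_g
  ⟨P.shortExact.exact.desc x hx, P.shortExact.exact.g_desc x hx⟩

lemma shortExact_mk {X Y Z : A} (f : X ⟶ Y) (g : Y ⟶ Z) (w : f ≫ g = 0)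
    (hf : Mono f) (hg : Epi g)
    (h : ∀ ⦃S : A⦄ (x : S ⟶ Y), x ≫ g = 0 →
      ∃ (S' : A) (π : S' ⟶ S) (_ : Epi π) (y : S' ⟶ X), π ≫ x = y ≫ f) :
    (ShortComplex.mk f g w).ShortExact where
  mono_f := hf
  epi_g := hg
  exact := by
    rw [ShortComplex.exact_iff_exact_up_to_refinements]
    exact h

variable {P Q}

lemma Rel.refl (P : Butterfly X Y) : Rel P P := ⟨Iso.refl _, by simp⟩

lemma Rel.symm (h : Rel P Q) : Rel Q P := by
  obtain ⟨e, h1, h2, h3, h4⟩ := h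
  exact ⟨e.symm, by simp [← h1], by simp [← h2], by simp [← h3], by simp [← h4]⟩

lemma Rel.trans {R : Butterfly X Y} (h : Rel P Q) (h' : Rel Q R) : Rel P R := by
  obtain ⟨e, h1, h2, h3, h4⟩ := h
  obtain ⟨e', h1', h2', h3', h4'⟩ := h'
  refine ⟨e ≪≫ e', ?_, ?_, ?_, ?_⟩
  · simp [← h1', ← h1]
  · simp [← h2', ← h2]
  · simp [← h3, ← h3']
  · simp [← h4, ← h4']

/-- A map of diagrams is automatically an isomorphism. -/
lemma Rel.of_hom (θ : P.E ⟶ Q.E) (h1 : P.κ ≫ θ = Q.κ) (h2 : P.ι ≫ θ = Q.ι)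
    (h3 : θ ≫ Q.σ = P.σ) (h4 : θ ≫ Q.ρ = P.ρ) : Rel P Q := by
  let φ : ShortComplex.mk P.ι P.σ P.ισ ⟶ ShortComplex.mk Q.ι Q.σ Q.ισ :=
    { τ₁ := 𝟙 _, τ₂ := θ, τ₃ := 𝟙 _, comm₁₂ := by simp [h2], comm₂₃ := by simp [h3] }
  have : IsIso θ := ShortComplex.isIso₂_of_shortExact_of_isIso₁₃' φ P.shortExact Q.shortExact
    (by dsimp [φ]; infer_instance) (by dsimp [φ]; infer_instance)
  exact ⟨asIso θ, h1, h2, h3, h4⟩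

/-- Two diagrams are identified if they receive compatible maps from a common object. -/
lemma Rel.of_span {L : A} (p : L ⟶ P.E) (q : L ⟶ Q.E) [Epi p]
    (h : ∀ ⦃S : A⦄ (x : S ⟶ L), x ≫ p = 0 → x ≫ q = 0)
    (k : X.neg ⟶ L) (hk : k ≫ p = P.κ) (hk' : k ≫ q = Q.κ)
    (i : Y.neg ⟶ L) (hi : i ≫ p = P.ι) (hi' : i ≫ q = Q.ι)
    (hσ : q ≫ Q.σ = p ≫ P.σ) (hρ : q ≫ Q.ρ = p ≫ P.ρ) : Rel P Q := by
  have hθ := Abelian.comp_epiDesc p q (h _ (kernel.condition p))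
  refine Rel.of_hom (Abelian.epiDesc p q (h _ (kernel.condition p))) ?_ ?_ ?_ ?_
  · rw [← hk, Category.assoc, hθ, hk']
  · rw [← hi, Category.assoc, hθ, hi']
  · rw [← cancel_epi p, ← Category.assoc, hθ, hσ]
  · rw [← cancel_epi p, ← Category.assoc, hθ, hρ]

lemma eq_zero_of_F (P : Butterfly X Y) {N : A} (hN : t.F N) (m : P.E ⟶ N)
    (h1 : P.κ ≫ m = 0) (h2 : P.ι ≫ m = 0) : m = 0 := by
  obtain ⟨g, rfl⟩ := P.exists_desc m h2
  rw [(t.T_cokernel_iff X.d).1 X.coker_mem hN g (by simpa using h1), comp_zero]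

lemma eq_zero_of_T (P : Butterfly X Y) {N : A} (hN : t.T N) (m : N ⟶ P.E)
    (h1 : m ≫ P.σ = 0) (h2 : m ≫ P.ρ = 0) : m = 0 := by
  obtain ⟨g, rfl⟩ := P.exists_lift m h1
  rw [(t.F_kernel_iff Y.d).1 Y.ker_mem hN g (by simpa using h2), zero_comp]

end

/-- The arrow `Y⁻¹ ⟶ E ×_{Y⁰} F` with components `ι` and `κ'`. -/
noncomputable abbrev compArrow {X Y Z : t.Tilt} (P : Butterfly X Y) (Q : Butterfly Y Z) :
    Y.neg ⟶ pullback P.ρ Q.σ :=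
  pullback.lift P.ι Q.κ (by simp)

/-- Composition of diagrams: the cokernel of `Y⁻¹ ⟶ E ×_{Y⁰} F`. -/
noncomputable def comp {X Y Z : t.Tilt} (P : Butterfly X Y) (Q : Butterfly Y Z) :
    Butterfly X Z where
  E := cokernel (compArrow P Q)
  κ := pullback.lift P.κ 0 (by simp) ≫ cokernel.π (compArrow P Q)
  ι := pullback.lift 0 Q.ι (by simp) ≫ cokernel.π (compArrow P Q)
  σ := cokernel.desc (compArrow P Q) (pullback.fst P.ρ Q.σ ≫ P.σ) (by simp)
  ρ := cokernel.desc (compArrow P Q) (pullback.snd P.ρ Q.σ ≫ Q.ρ) (by simp)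
  κσ := by simp
  ιρ := by simp
  κρ := by simp
  ισ := by simp
  shortExact := by
    refine shortExact_mk _ _ _ ?_ ?_ ?_
    · refine Preadditive.mono_of_cancel_zero _ fun {S} z hz => ?_
      rw [← Category.assoc] at hz
      obtain ⟨S', π, hπ, y, hy⟩ :=
        (ShortComplex.exact_cokernel (compArrow P Q)).exact_up_to_refinements _ hz
      dsimp at y hy
      have h1 : y = 0 := by
        rw [← cancel_mono P.ι]
        simpa using ((hy =≫ pullback.fst _ _)).symm
      have h2 := hy =≫ pullback.snd _ _
      rw [← cancel_epi π, comp_zero, ← cancel_mono Q.ι]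
      simpa [h1] using h2
    · have : Epi (cokernel.π (compArrow P Q) ≫ cokernel.desc (compArrow P Q)
          (pullback.fst P.ρ Q.σ ≫ P.σ) (by simp)) := by
        rw [cokernel.π_desc]; infer_instance
      exact epi_of_epi (cokernel.π (compArrow P Q)) _
    · intro S x hx
      obtain ⟨S', π, hπ, l, hl⟩ :=
        surjective_up_to_refinements_of_epi (cokernel.π (compArrow P Q)) x
      have h1 : (l ≫ pullback.fst _ _) ≫ P.σ = 0 := by
        have := hl =≫ cokernel.desc (compArrow P Q) (pullback.fst P.ρ Q.σ ≫ P.σ) (by simp)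
        simpa [hx] using this.symm
      obtain ⟨y, hy⟩ := P.exists_lift _ h1
      have h2 : (l ≫ pullback.snd _ _ - y ≫ Q.κ) ≫ Q.σ = 0 := by
        rw [Preadditive.sub_comp, Category.assoc, ← pullback.condition, ← Category.assoc, ← hy]
        simp
      obtain ⟨z, hz⟩ := Q.exists_lift _ h2
      refine ⟨S', π, hπ, z, ?_⟩
      have h3 : l = z ≫ pullback.lift 0 Q.ι (by simp) + y ≫ compArrow P Q := by
        apply pullback.hom_ext
        · simp [hy]
        · simp [hz]
      rw [hl, h3]
      simp

section Interface

variable {X Y Z : t.Tilt}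

/-- The projection `E ×_{Y⁰} F ⟶ (comp P Q).E`. -/
noncomputable def compπ (P : Butterfly X Y) (Q : Butterfly Y Z) :
    pullback P.ρ Q.σ ⟶ (comp P Q).E :=
  cokernel.π (compArrow P Q)

variable (P : Butterfly X Y) (Q : Butterfly Y Z)

instance : Epi (compπ P Q) := inferInstanceAs (Epi (cokernel.π (compArrow P Q)))

lemma compArrow_π : compArrow P Q ≫ compπ P Q = 0 := cokernel.condition _

lemma comp_κ (w : P.κ ≫ P.ρ = 0 ≫ Q.σ) : pullback.lift P.κ 0 w ≫ compπ P Q = (comp P Q).κ := rfl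

lemma comp_ι (w : 0 ≫ P.ρ = Q.ι ≫ Q.σ) : pullback.lift 0 Q.ι w ≫ compπ P Q = (comp P Q).ι := rfl

lemma compπ_σ : compπ P Q ≫ (comp P Q).σ = pullback.fst _ _ ≫ P.σ := cokernel.π_desc _ _ _

lemma compπ_ρ : compπ P Q ≫ (comp P Q).ρ = pullback.snd _ _ ≫ Q.ρ := cokernel.π_desc _ _ _

variable {P Q}

lemma exists_comp_desc {S : A} (θ : pullback P.ρ Q.σ ⟶ S) (h : compArrow P Q ≫ θ = 0) :
    ∃ m : (comp P Q).E ⟶ S, compπ P Q ≫ m = θ :=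
  ⟨cokernel.desc _ θ h, cokernel.π_desc _ _ _⟩

lemma exists_of_compπ_eq_zero {S : A} (x : S ⟶ pullback P.ρ Q.σ) (h : x ≫ compπ P Q = 0) :
    ∃ (S' : A) (π : S' ⟶ S) (_ : Epi π) (y : S' ⟶ Y.neg), π ≫ x = y ≫ compArrow P Q :=
  (ShortComplex.exact_cokernel (compArrow P Q)).exact_up_to_refinements x h

variable (P Q)

lemma compArrow_fst : compArrow P Q ≫ pullback.fst _ _ = P.ι := pullback.lift_fst _ _ _

lemma compArrow_snd : compArrow P Q ≫ pullback.snd _ _ = Q.κ := pullback.lift_snd _ _ _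

lemma compArrow_fst_assoc {S : A} (h : P.E ⟶ S) :
    compArrow P Q ≫ pullback.fst _ _ ≫ h = P.ι ≫ h := by
  rw [← Category.assoc, compArrow_fst]

lemma compArrow_snd_assoc {S : A} (h : Q.E ⟶ S) :
    compArrow P Q ≫ pullback.snd _ _ ≫ h = Q.κ ≫ h := by
  rw [← Category.assoc, compArrow_snd]

lemma compArrow_π_assoc {S : A} (h : (comp P Q).E ⟶ S) :
    compArrow P Q ≫ compπ P Q ≫ h = 0 := by
  rw [← Category.assoc, compArrow_π, zero_comp]

lemma compπ_σ_assoc {S : A} (h : X.zer ⟶ S) :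
    compπ P Q ≫ (comp P Q).σ ≫ h = pullback.fst _ _ ≫ P.σ ≫ h := by
  rw [← Category.assoc, compπ_σ, Category.assoc]

lemma compπ_ρ_assoc {S : A} (h : Z.zer ⟶ S) :
    compπ P Q ≫ (comp P Q).ρ ≫ h = pullback.snd _ _ ≫ Q.ρ ≫ h := by
  rw [← Category.assoc, compπ_ρ, Category.assoc]

lemma comp_κ_assoc (w : P.κ ≫ P.ρ = 0 ≫ Q.σ) {S : A} (h : (comp P Q).E ⟶ S) :
    pullback.lift P.κ 0 w ≫ compπ P Q ≫ h = (comp P Q).κ ≫ h := by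
  rw [← Category.assoc, comp_κ]

lemma comp_ι_assoc (w : 0 ≫ P.ρ = Q.ι ≫ Q.σ) {S : A} (h : (comp P Q).E ⟶ S) :
    pullback.lift 0 Q.ι w ≫ compπ P Q ≫ h = (comp P Q).ι ≫ h := by
  rw [← Category.assoc, comp_ι]

attribute [simp] compArrow_fst compArrow_snd compArrow_fst_assoc compArrow_snd_assoc
  compArrow_π compArrow_π_assoc compπ_σ compπ_ρ compπ_σ_assoc compπ_ρ_assoc comp_κ comp_ι
  comp_κ_assoc comp_ι_assoc

end Interface

/-- The diagram of a morphism of complexes `X ⟶ Y` with components `f` and `g` in degrees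
`-1` and `0`. -/
noncomputable def strict {X Y : t.Tilt} (f : X.neg ⟶ Y.neg) (g : X.zer ⟶ Y.zer)
    (w : X.d ≫ g = f ≫ Y.d) : Butterfly X Y where
  E := X.zer ⊞ Y.neg
  κ := biprod.lift X.d (-f)
  ι := biprod.inr
  σ := biprod.fst
  ρ := biprod.desc g Y.d
  κσ := by simp
  ιρ := by simp
  κρ := by simp [w]
  ισ := by simp
  shortExact := by
    refine shortExact_mk _ _ _ inferInstance inferInstance fun S x hx => ?_
    refine ⟨S, 𝟙 S, inferInstance, x ≫ biprod.snd, ?_⟩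
    apply biprod.hom_ext <;> simp [hx]

section Interface

variable {X Y : t.Tilt} (f : X.neg ⟶ Y.neg) (g : X.zer ⟶ Y.zer) (w : X.d ≫ g = f ≫ Y.d)

/-- The section of `σ` for a strict morphism. -/
noncomputable def strictInl : X.zer ⟶ (strict f g w).E := biprod.inl

/-- The retraction of `ι` for a strict morphism. -/
noncomputable def strictSnd : (strict f g w).E ⟶ Y.neg := biprod.snd

lemma strictInl_σ : strictInl f g w ≫ (strict f g w).σ = 𝟙 _ := biprod.inl_fst
lemma strictInl_snd : strictInl f g w ≫ strictSnd f g w = 0 := biprod.inl_snd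
lemma strict_ι_snd : (strict f g w).ι ≫ strictSnd f g w = 𝟙 _ := biprod.inr_snd
lemma strictInl_ρ : strictInl f g w ≫ (strict f g w).ρ = g := biprod.inl_desc _ _
lemma strict_κ_snd : (strict f g w).κ ≫ strictSnd f g w = -f := biprod.lift_snd _ _

lemma strict_total : (strict f g w).σ ≫ strictInl f g w + strictSnd f g w ≫ (strict f g w).ι = 𝟙 _ :=
  biprod.total

lemma strictInl_σ_assoc {S : A} (h : X.zer ⟶ S) :
    strictInl f g w ≫ (strict f g w).σ ≫ h = h := by
  rw [← Category.assoc, strictInl_σ, Category.id_comp]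
lemma strictInl_snd_assoc {S : A} (h : Y.neg ⟶ S) :
    strictInl f g w ≫ strictSnd f g w ≫ h = 0 := by
  rw [← Category.assoc, strictInl_snd, zero_comp]
lemma strict_ι_snd_assoc {S : A} (h : Y.neg ⟶ S) :
    (strict f g w).ι ≫ strictSnd f g w ≫ h = h := by
  rw [← Category.assoc, strict_ι_snd, Category.id_comp]
lemma strictInl_ρ_assoc {S : A} (h : Y.zer ⟶ S) :
    strictInl f g w ≫ (strict f g w).ρ ≫ h = g ≫ h := by
  rw [← Category.assoc, strictInl_ρ]
lemma strict_κ_snd_assoc {S : A} (h : Y.neg ⟶ S) :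
    (strict f g w).κ ≫ strictSnd f g w ≫ h = -f ≫ h := by
  rw [← Category.assoc, strict_κ_snd, Preadditive.neg_comp]

attribute [simp] strictInl_σ strictInl_snd strict_ι_snd strictInl_ρ strict_κ_snd
  strictInl_σ_assoc strictInl_snd_assoc strict_ι_snd_assoc strictInl_ρ_assoc strict_κ_snd_assoc

variable {f g w}

lemma strict_ext {S : A} {x y : S ⟶ (strict f g w).E}
    (h1 : x ≫ (strict f g w).σ = y ≫ (strict f g w).σ)
    (h2 : x ≫ strictSnd f g w = y ≫ strictSnd f g w) : x = y :=
  biprod.hom_ext _ _ h1 h2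

lemma strict_ext' {S : A} {x y : (strict f g w).E ⟶ S}
    (h1 : strictInl f g w ≫ x = strictInl f g w ≫ y)
    (h2 : (strict f g w).ι ≫ x = (strict f g w).ι ≫ y) : x = y :=
  biprod.hom_ext' _ _ h1 h2

lemma strict_ρ : (strict f g w).ρ = (strict f g w).σ ≫ g + strictSnd f g w ≫ Y.d := by
  apply strict_ext' <;> simp

end Interface

section

variable {X Y Z W : t.Tilt}

lemma comp_rel (P : Butterfly X Y) (Q : Butterfly Y Z) (R : Butterfly X Z)
    (θ : pullback P.ρ Q.σ ⟶ R.E) (hj : compArrow P Q ≫ θ = 0)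
    (hκ : pullback.lift P.κ 0 (by simp) ≫ θ = R.κ)
    (hι : pullback.lift 0 Q.ι (by simp) ≫ θ = R.ι)
    (hσ : θ ≫ R.σ = pullback.fst P.ρ Q.σ ≫ P.σ)
    (hρ : θ ≫ R.ρ = pullback.snd P.ρ Q.σ ≫ Q.ρ) : Rel (comp P Q) R := by
  obtain ⟨m, rfl⟩ := exists_comp_desc θ hj
  refine Rel.of_hom m ?_ ?_ ?_ ?_
  · simpa using hκ
  · simpa using hι
  · rw [← cancel_epi (compπ P Q)]; simpa using hσ
  · rw [← cancel_epi (compπ P Q)]; simpa using hρ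

lemma comp_congr {P P' : Butterfly X Y} {Q Q' : Butterfly Y Z} (h : Rel P P') (h' : Rel Q Q') :
    Rel (comp P Q) (comp P' Q') := by
  obtain ⟨e, h1, h2, h3, h4⟩ := h
  obtain ⟨e', h1', h2', h3', h4'⟩ := h'
  have hw : (pullback.fst P.ρ Q.σ ≫ e.hom) ≫ P'.ρ = (pullback.snd P.ρ Q.σ ≫ e'.hom) ≫ Q'.σ := by
    simp [h4, h3', pullback.condition]
  refine comp_rel P Q (comp P' Q') (pullback.lift _ _ hw ≫ compπ P' Q') ?_ ?_ ?_ ?_ ?_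
  · have : compArrow P Q ≫ pullback.lift _ _ hw = compArrow P' Q' := by
      apply pullback.hom_ext <;> simp [h2, h1']
    rw [← Category.assoc, this, compArrow_π]
  · have : pullback.lift P.κ 0 (by simp) ≫ pullback.lift _ _ hw =
        pullback.lift P'.κ 0 (by simp) := by
      apply pullback.hom_ext <;> simp [h1]
    rw [← Category.assoc, this, comp_κ]
  · have : pullback.lift 0 Q.ι (by simp) ≫ pullback.lift _ _ hw =
        pullback.lift 0 Q'.ι (by simp) := by
      apply pullback.hom_ext <;> simp [h2']
    rw [← Category.assoc, this, comp_ι]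
  · simp [h3]
  · simp [h4']

lemma comp_assoc (P : Butterfly X Y) (Q : Butterfly Y Z) (R : Butterfly Z W) :
    Rel (comp (comp P Q) R) (comp P (comp Q R)) := by
  -- `L` consists of the triples `(e, f, g)`, as pairs `((e, f), g)`
  let L := pullback (pullback.snd P.ρ Q.σ ≫ Q.ρ) R.σ
  obtain ⟨u, hu⟩ : ∃ u : L ⟶ pullback P.ρ Q.σ, u = pullback.fst _ _ := ⟨_, rfl⟩
  obtain ⟨g, hg⟩ : ∃ g : L ⟶ R.E, g = pullback.snd _ _ := ⟨_, rfl⟩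
  have hcond : u ≫ pullback.snd P.ρ Q.σ ≫ Q.ρ = g ≫ R.σ := by
    rw [hu, hg]; exact pullback.condition
  have hug : (u ≫ compπ P Q) ≫ (comp P Q).ρ = g ≫ R.σ := by simp [hcond]
  have hug' : (u ≫ pullback.snd _ _) ≫ Q.ρ = g ≫ R.σ := by simp [hcond]
  obtain ⟨p, hp1, hp2⟩ : ∃ p : L ⟶ pullback (comp P Q).ρ R.σ,
      p ≫ pullback.fst _ _ = u ≫ compπ P Q ∧ p ≫ pullback.snd _ _ = g :=
    ⟨pullback.lift _ _ hug, by simp, by simp⟩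
  obtain ⟨q', hq1', hq2'⟩ : ∃ q' : L ⟶ pullback Q.ρ R.σ,
      q' ≫ pullback.fst _ _ = u ≫ pullback.snd _ _ ∧ q' ≫ pullback.snd _ _ = g :=
    ⟨pullback.lift _ _ hug', by simp, by simp⟩
  have hq' : (u ≫ pullback.fst _ _) ≫ P.ρ = (q' ≫ compπ Q R) ≫ (comp Q R).σ := by
    simp [pullback.condition, reassoc_of% hq1']
  obtain ⟨q, hq1, hq2⟩ : ∃ q : L ⟶ pullback P.ρ (comp Q R).σ,
      q ≫ pullback.fst _ _ = u ≫ pullback.fst _ _ ∧ q ≫ pullback.snd _ _ = q' ≫ compπ Q R :=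
    ⟨pullback.lift _ _ hq', by simp, by simp⟩
  have hL {S : A} (x : S ⟶ pullback P.ρ Q.σ) (y : S ⟶ R.E)
      (h : x ≫ pullback.snd P.ρ Q.σ ≫ Q.ρ = y ≫ R.σ) : ∃ z : S ⟶ L, z ≫ u = x ∧ z ≫ g = y :=
    ⟨pullback.lift x y h, by simp [hu], by simp [hg]⟩
  have hp : Epi p := by
    rw [epi_iff_surjective_up_to_refinements]
    intro S y
    obtain ⟨S', π, hπ, x, hx⟩ :=
      surjective_up_to_refinements_of_epi (compπ P Q) (y ≫ pullback.fst _ _)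
    obtain ⟨z, hz1, hz2⟩ := hL x (π ≫ y ≫ pullback.snd _ _) (by
      have := hx =≫ (comp P Q).ρ
      simp only [Category.assoc, compπ_ρ, pullback.condition] at this
      simp [← this])
    refine ⟨S', π, hπ, z, ?_⟩
    apply pullback.hom_ext
    · simp [hp1, reassoc_of% hz1, hx]
    · simp [hp2, hz2]
  obtain ⟨k, hk1, hk2⟩ := hL (pullback.lift P.κ 0 (by simp)) 0 (by simp)
  obtain ⟨i, hi1, hi2⟩ := hL 0 R.ι (by simp)
  refine Rel.of_span (P := comp (comp P Q) R) (Q := comp P (comp Q R)) (L := L)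
    (p ≫ compπ (comp P Q) R) (q ≫ compπ P (comp Q R)) ?_ k ?_ ?_ i ?_ ?_ ?_ ?_
  · intro S x hx
    rw [← Category.assoc] at hx
    obtain ⟨S₁, π₁, hπ₁, z, hz⟩ := exists_of_compπ_eq_zero _ hx
    have hz1 : π₁ ≫ x ≫ u ≫ compπ P Q = z ≫ (comp P Q).ι := by
      simpa [hp1] using hz =≫ pullback.fst _ _
    have hz2 : π₁ ≫ x ≫ g = z ≫ R.κ := by
      simpa [hp2] using hz =≫ pullback.snd _ _
    have h0 : (π₁ ≫ x ≫ u - z ≫ pullback.lift 0 Q.ι (by simp)) ≫ compπ P Q = 0 := by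
      rw [Preadditive.sub_comp, sub_eq_zero]
      simpa using hz1
    obtain ⟨S₂, π₂, hπ₂, y, hy⟩ := exists_of_compπ_eq_zero _ h0
    have hy1 : π₂ ≫ π₁ ≫ x ≫ u ≫ pullback.fst _ _ = y ≫ P.ι := by
      simpa using hy =≫ pullback.fst _ _
    have hy2 : π₂ ≫ π₁ ≫ x ≫ u ≫ pullback.snd _ _ = π₂ ≫ z ≫ Q.ι + y ≫ Q.κ := by
      have := hy =≫ pullback.snd _ _
      simp only [Preadditive.comp_sub, Preadditive.sub_comp, Category.assoc, pullback.lift_snd,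
        sub_eq_iff_eq_add] at this
      rw [this, add_comm]
    have hxq' : π₂ ≫ π₁ ≫ x ≫ q' = (π₂ ≫ z) ≫ compArrow Q R +
        y ≫ pullback.lift Q.κ 0 (by simp) := by
      apply pullback.hom_ext
      · simp [hq1', hy2]
      · simp [hq2', hz2]
    have hxq : π₂ ≫ π₁ ≫ x ≫ q = y ≫ compArrow P (comp Q R) := by
      apply pullback.hom_ext
      · simp [hq1, hy1]
      · simpa [hq2] using hxq' =≫ compπ Q R
    rw [← cancel_epi π₁, ← cancel_epi π₂]
    simpa using hxq =≫ compπ P (comp Q R)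
  · have : k ≫ p = pullback.lift (comp P Q).κ 0 (by simp) := by
      apply pullback.hom_ext
      · simp [hp1, reassoc_of% hk1]
      · simp [hp2, hk2]
    rw [reassoc_of% this, comp_κ]
  · have h0 : k ≫ q' = 0 := by
      apply pullback.hom_ext
      · simp [hq1', reassoc_of% hk1]
      · simp [hq2', hk2]
    have : k ≫ q = pullback.lift P.κ 0 (by simp) := by
      apply pullback.hom_ext
      · simp [hq1, reassoc_of% hk1]
      · simp [hq2, reassoc_of% h0]
    rw [reassoc_of% this, comp_κ]
  · have : i ≫ p = pullback.lift 0 R.ι (by simp) := by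
      apply pullback.hom_ext
      · simp [hp1, reassoc_of% hi1]
      · simp [hp2, hi2]
    rw [reassoc_of% this, comp_ι]
  · have h0 : i ≫ q' = pullback.lift 0 R.ι (by simp) := by
      apply pullback.hom_ext
      · simp [hq1', reassoc_of% hi1]
      · simp [hq2', hi2]
    have : i ≫ q = pullback.lift 0 (comp Q R).ι (by simp) := by
      apply pullback.hom_ext
      · simp [hq1, reassoc_of% hi1]
      · simp [hq2, reassoc_of% h0]
    rw [reassoc_of% this, comp_ι]
  · simp [reassoc_of% hp1, reassoc_of% hq1]
  · simp [reassoc_of% hp2, reassoc_of% hq2, reassoc_of% hq2']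

lemma strict_comp_iff (f : X.neg ⟶ Y.neg) (g : X.zer ⟶ Y.zer) (w : X.d ≫ g = f ≫ Y.d)
    (Q : Butterfly Y Z) (R : Butterfly X Z) :
    Rel (comp (strict f g w) Q) R ↔ ∃ θ : R.E ⟶ Q.E, R.κ ≫ θ = f ≫ Q.κ ∧ R.ι ≫ θ = Q.ι ∧
      θ ≫ Q.σ = R.σ ≫ g ∧ θ ≫ Q.ρ = R.ρ := by
  constructor
  · intro h
    obtain ⟨e, h1, h2, h3, h4⟩ := h.symm
    obtain ⟨m, hm⟩ := exists_comp_desc (P := strict f g w) (Q := Q)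
      (pullback.snd _ _ - pullback.fst _ _ ≫ strictSnd f g w ≫ Q.κ) (by simp)
    refine ⟨e.hom ≫ m, ?_, ?_, ?_, ?_⟩
    · rw [← Category.assoc, h1, ← comp_κ _ _ (by simp), Category.assoc, hm]
      simp
    · rw [← Category.assoc, h2, ← comp_ι _ _ (by simp), Category.assoc, hm]
      simp
    · rw [← h3, Category.assoc, Category.assoc]
      congr 1
      rw [← cancel_epi (compπ _ _), ← Category.assoc, hm, Preadditive.sub_comp,
        ← pullback.condition, sub_eq_iff_eq_add]
      refine (congrArg (pullback.fst (strict f g w).ρ Q.σ ≫ ·) strict_ρ).trans ?_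
      simp
    · rw [← h4, Category.assoc]
      congr 1
      rw [← cancel_epi (compπ _ _), ← Category.assoc, hm]
      simp
  · rintro ⟨θ, h1, h2, h3, h4⟩
    have hw : (R.σ ≫ strictInl f g w) ≫ (strict f g w).ρ = θ ≫ Q.σ := by
      simp [h3]
    refine (Rel.of_hom (P := R) (Q := comp (strict f g w) Q)
      (pullback.lift _ _ hw ≫ compπ _ _) ?_ ?_ ?_ ?_).symm
    · have : R.κ ≫ pullback.lift _ _ hw - pullback.lift (strict f g w).κ 0 (by simp) =
          f ≫ compArrow (strict f g w) Q := by
        apply pullback.hom_ext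
        · apply strict_ext <;> simp
        · simp [h1]
      rw [sub_eq_iff_eq_add] at this
      rw [reassoc_of% this]
      simp
    · have : R.ι ≫ pullback.lift _ _ hw = pullback.lift 0 Q.ι (by simp) := by
        apply pullback.hom_ext
        · simp
        · simp [h2]
      rw [reassoc_of% this, comp_ι]
    · simp
    · simp [h4]

lemma comp_strict_iff (P : Butterfly X Y) (f : Y.neg ⟶ Z.neg) (g : Y.zer ⟶ Z.zer)
    (w : Y.d ≫ g = f ≫ Z.d) (R : Butterfly X Z) :
    Rel (comp P (strict f g w)) R ↔ ∃ θ : P.E ⟶ R.E, P.κ ≫ θ = R.κ ∧ P.ι ≫ θ = f ≫ R.ι ∧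
      θ ≫ R.σ = P.σ ∧ θ ≫ R.ρ = P.ρ ≫ g := by
  constructor
  · rintro ⟨e, h1, h2, h3, h4⟩
    have hw : 𝟙 P.E ≫ P.ρ = (P.ρ ≫ strictInl f g w) ≫ (strict f g w).σ := by simp
    refine ⟨(pullback.lift _ _ hw ≫ compπ P (strict f g w)) ≫ e.hom, ?_, ?_, ?_, ?_⟩
    · have : P.κ ≫ pullback.lift _ _ hw = pullback.lift P.κ 0 (by simp) := by
        apply pullback.hom_ext
        · simp
        · simp
      rw [Category.assoc, reassoc_of% this, comp_κ_assoc, h1]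
    · have : P.ι ≫ pullback.lift _ _ hw =
          f ≫ pullback.lift 0 (strict f g w).ι (by simp) + compArrow P (strict f g w) := by
        apply pullback.hom_ext
        · simp
        · apply strict_ext <;> simp
      rw [Category.assoc, reassoc_of% this]
      simp [h2]
    · simp [h3]
    · simp [h4]
  · rintro ⟨θ, h1, h2, h3, h4⟩
    refine comp_rel P (strict f g w) R
      (pullback.fst _ _ ≫ θ + pullback.snd _ _ ≫ strictSnd f g w ≫ R.ι) ?_ ?_ ?_ ?_ ?_
    · simp [h2]
    · simp [h1]
    · simp
    · simp [h3]
    · have : pullback.fst P.ρ (strict f g w).σ ≫ P.ρ =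
          pullback.snd P.ρ (strict f g w).σ ≫ (strict f g w).σ := pullback.condition
      simp [h4, reassoc_of% this, strict_ρ]

lemma comp_zero_iff (P : Butterfly X Y) (Q : Butterfly Y Z) :
    Rel (comp P Q) (strict 0 0 (by simp)) ↔ ∃ θ : P.E ⟶ Q.E,
      P.κ ≫ θ = 0 ∧ P.ι ≫ θ = Q.κ ∧ θ ≫ Q.σ = P.ρ ∧ θ ≫ Q.ρ = 0 := by
  constructor
  · rintro ⟨e, h1, h2, h3, h4⟩
    let r : pullback P.ρ Q.σ ⟶ Z.neg := compπ P Q ≫ e.hom ≫ strictSnd _ _ _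
    have hr1 : pullback.lift P.κ 0 (by simp) ≫ r = 0 := by
      simp [r, reassoc_of% h1]
    have hr2 : pullback.lift 0 Q.ι (by simp) ≫ r = 𝟙 _ := by
      simp [r, reassoc_of% h2]
    have hr3 : r ≫ Z.d = pullback.snd _ _ ≫ Q.ρ := by
      simpa [strict_ρ, r] using compπ P Q ≫= h4
    have hr4 : compArrow P Q ≫ r = 0 := by simp [r]
    let m : pullback P.ρ Q.σ ⟶ Q.E := pullback.snd _ _ - r ≫ Q.ι
    have hm : kernel.ι (pullback.fst P.ρ Q.σ) ≫ m = 0 := by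
      obtain ⟨z, hz⟩ := Q.exists_lift (kernel.ι (pullback.fst P.ρ Q.σ) ≫ pullback.snd _ _)
        (by rw [Category.assoc, ← pullback.condition, kernel.condition_assoc, zero_comp])
      have : kernel.ι (pullback.fst P.ρ Q.σ) = z ≫ pullback.lift 0 Q.ι (by simp) := by
        apply pullback.hom_ext <;> simp [hz]
      rw [this]
      simp [m, reassoc_of% hr2]
    have hθ := Abelian.comp_epiDesc _ m hm
    refine ⟨Abelian.epiDesc _ m hm, ?_, ?_, ?_, ?_⟩
    · have : P.κ = pullback.lift P.κ 0 (by simp) ≫ pullback.fst P.ρ Q.σ := by simp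
      rw [this, Category.assoc, hθ]
      simp [m, reassoc_of% hr1]
    · have : P.ι = compArrow P Q ≫ pullback.fst P.ρ Q.σ := by simp
      rw [this, Category.assoc, hθ]
      simp [m, reassoc_of% hr4]
    · rw [← cancel_epi (pullback.fst P.ρ Q.σ), ← Category.assoc, hθ, pullback.condition]
      simp [m]
    · rw [← cancel_epi (pullback.fst P.ρ Q.σ), ← Category.assoc, hθ]
      simp [m, hr3]
  · rintro ⟨θ, h1, h2, h3, h4⟩
    obtain ⟨r, hr⟩ := Q.exists_lift (pullback.snd P.ρ Q.σ - pullback.fst P.ρ Q.σ ≫ θ)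
      (by simp [h3, pullback.condition])
    refine comp_rel P Q _ (pullback.fst P.ρ Q.σ ≫ P.σ ≫ strictInl _ _ _ + r ≫ (strict _ _ _).ι)
      ?_ ?_ ?_ ?_ ?_
    · apply strict_ext
      · simp
      · rw [← cancel_mono Q.ι]
        simp [hr, h2]
    · apply strict_ext
      · simp
      · rw [← cancel_mono Q.ι]
        simp [hr, h1]
    · apply strict_ext
      · simp
      · rw [← cancel_mono Q.ι]
        simp [hr]
    · simp
    · have h5 := hr =≫ Q.ρ
      simpa [h4] using h5

lemma id_comp (P : Butterfly X Y) : Rel (comp (strict (𝟙 _) (𝟙 _) (by simp)) P) P :=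
  (strict_comp_iff _ _ _ P P).2 ⟨𝟙 _, by simp⟩

lemma comp_id (P : Butterfly X Y) : Rel (comp P (strict (𝟙 _) (𝟙 _) (by simp))) P :=
  (comp_strict_iff P _ _ _ P).2 ⟨𝟙 _, by simp⟩

lemma strict_comp_strict (f : X.neg ⟶ Y.neg) (g : X.zer ⟶ Y.zer) (w : X.d ≫ g = f ≫ Y.d)
    (f' : Y.neg ⟶ Z.neg) (g' : Y.zer ⟶ Z.zer) (w' : Y.d ≫ g' = f' ≫ Z.d)
    (w'' : X.d ≫ g ≫ g' = (f ≫ f') ≫ Z.d) :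
    Rel (comp (strict f g w) (strict f' g' w')) (strict (f ≫ f') (g ≫ g') w'') := by
  refine (comp_strict_iff _ _ _ _ _).2 ⟨(strict f g w).σ ≫ strictInl _ _ _ +
    strictSnd f g w ≫ f' ≫ (strict _ _ _).ι, ?_, ?_, ?_, ?_⟩
  · apply strict_ext <;> simp
  · simp
  · simp
  · simp [strict_ρ, w']

lemma zero_comp_rel (Q : Butterfly Y Z) :
    Rel (comp (strict (0 : X.neg ⟶ Y.neg) 0 (by simp)) Q) (strict 0 0 (by simp)) := by
  refine (strict_comp_iff _ _ _ _ _).2 ⟨strictSnd _ _ _ ≫ Q.ι, ?_, ?_, ?_, ?_⟩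
  · simp
  · simp
  · simp
  · simp [strict_ρ]

lemma comp_zero_rel (P : Butterfly X Y) :
    Rel (comp P (strict (0 : Y.neg ⟶ Z.neg) 0 (by simp))) (strict 0 0 (by simp)) := by
  refine (comp_strict_iff _ _ _ _ _).2 ⟨P.σ ≫ strictInl _ _ _, ?_, ?_, ?_, ?_⟩
  · apply strict_ext <;> simp
  · simp
  · simp
  · simp

/-- Flipping a diagram whose other diagonal is short exact. -/
def flip (P : Butterfly X Y) (h : (ShortComplex.mk P.κ P.ρ P.κρ).ShortExact) :
    Butterfly Y X where
  E := P.E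
  κ := P.ι
  ι := P.κ
  σ := P.ρ
  ρ := P.σ
  κσ := P.ιρ
  ιρ := P.κσ
  κρ := P.ισ
  ισ := P.κρ
  shortExact := h

/-- Two diagrams that are flips of each other are inverse morphisms. -/
lemma comp_flip (P : Butterfly X Y) (Q : Butterfly Y X) (e : P.E ≅ Q.E)
    (h1 : P.ι ≫ e.hom = Q.κ) (h2 : P.κ ≫ e.hom = Q.ι) (h3 : e.hom ≫ Q.σ = P.ρ)
    (h4 : e.hom ≫ Q.ρ = P.σ) :
    Rel (comp P Q) (strict (𝟙 _) (𝟙 _) (by simp)) := by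
  obtain ⟨r, hr⟩ := Q.exists_lift (pullback.snd P.ρ Q.σ - pullback.fst P.ρ Q.σ ≫ e.hom) (by
      rw [Preadditive.sub_comp, ← pullback.condition, Category.assoc, h3, sub_self])
  refine comp_rel P _ _ (pullback.fst P.ρ Q.σ ≫ P.σ ≫ strictInl _ _ _ + r ≫ (strict _ _ _).ι)
    ?_ ?_ ?_ ?_ ?_
  · apply strict_ext
    · simp
    · rw [← cancel_mono Q.ι]
      simp [hr, h1]
  · apply strict_ext
    · simp
    · rw [← cancel_mono Q.ι]
      simp [hr, h2]
  · apply strict_ext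
    · simp
    · rw [← cancel_mono Q.ι]
      simp [hr]
  · simp
  · have := hr =≫ Q.ρ
    simp only [Category.assoc, Q.ιρ, Preadditive.sub_comp, h4] at this
    simp [this]

/-- A strict morphism that is invertible in degree `-1` and whose kernel in degree `0` lies in
`F` is left cancellable. -/
lemma rel_of_comp_strict (f : Y.neg ⟶ Z.neg) (g : Y.zer ⟶ Z.zer) (w : Y.d ≫ g = f ≫ Z.d)
    (hf : IsIso f) (hg : t.F (kernel g)) (P Q : Butterfly X Y)
    (h : Rel (comp P (strict f g w)) (comp Q (strict f g w))) : Rel P Q := by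
  obtain ⟨θ, h1, h2, h3, h4⟩ := (comp_strict_iff P f g w _).1 h
  obtain ⟨θ', h1', h2', h3', h4'⟩ := (comp_strict_iff Q f g w _).1 (Rel.refl _)
  let R := comp Q (strict f g w)
  let φ : ShortComplex.mk Q.ι Q.σ Q.ισ ⟶ ShortComplex.mk R.ι R.σ R.ισ :=
    { τ₁ := f, τ₂ := θ', τ₃ := 𝟙 _, comm₁₂ := by simp [R, h2'], comm₂₃ := by simp [R, h3'] }
  have : IsIso θ' := ShortComplex.isIso₂_of_shortExact_of_isIso₁₃' φ Q.shortExact R.shortExact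
    hf (by dsimp [φ]; infer_instance)
  have hκ : P.κ ≫ θ ≫ inv θ' = Q.κ := by
    rw [← cancel_mono θ']; simp [h1, h1']
  have hι : P.ι ≫ θ ≫ inv θ' = Q.ι := by
    rw [← cancel_mono θ']; simp [h2, h2']
  have hρ : ((θ ≫ inv θ') ≫ Q.ρ - P.ρ) ≫ g = 0 := by
    simp [← h4, ← h4']
  have hz := P.eq_zero_of_F hg (kernel.lift g _ hρ)
    (by rw [← cancel_mono (kernel.ι g)]; simp [reassoc_of% hκ])
    (by rw [← cancel_mono (kernel.ι g)]; simp [reassoc_of% hι])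
  refine Rel.of_hom (θ ≫ inv θ') hκ hι (by simp [← h3', h3]) ?_
  rw [← sub_eq_zero, ← kernel.lift_ι g _ hρ, hz, zero_comp]

/-- A strict morphism that is invertible in degree `0` and whose cokernel in degree `-1` lies in
`T` is right cancellable. -/
lemma rel_of_strict_comp (f : X.neg ⟶ Y.neg) (g : X.zer ⟶ Y.zer) (w : X.d ≫ g = f ≫ Y.d)
    (hf : t.T (cokernel f)) (hg : IsIso g) (P Q : Butterfly Y Z)
    (h : Rel (comp (strict f g w) P) (comp (strict f g w) Q)) : Rel P Q := by
  obtain ⟨θ, h1, h2, h3, h4⟩ := (strict_comp_iff f g w P _).1 h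
  obtain ⟨θ', h1', h2', h3', h4'⟩ := (strict_comp_iff f g w Q _).1 (Rel.refl _)
  let R := comp (strict f g w) Q
  let φ : ShortComplex.mk R.ι R.σ R.ισ ⟶ ShortComplex.mk P.ι P.σ P.ισ :=
    { τ₁ := 𝟙 _, τ₂ := θ, τ₃ := g, comm₁₂ := by simp [R, h2], comm₂₃ := by simp [R, h3] }
  have : IsIso θ := ShortComplex.isIso₂_of_shortExact_of_isIso₁₃' φ R.shortExact P.shortExact
    (by dsimp [φ]; infer_instance) hg
  have hσ : (inv θ ≫ θ') ≫ Q.σ = P.σ := by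
    rw [← cancel_epi θ]; simp [h3, h3']
  have hρ : (inv θ ≫ θ') ≫ Q.ρ = P.ρ := by
    rw [← cancel_epi θ]; simp [h4, h4']
  have hκ : f ≫ (P.κ ≫ (inv θ ≫ θ') - Q.κ) = 0 := by
    rw [Preadditive.comp_sub, ← h1', ← reassoc_of% h1]; simp
  have hz := Q.eq_zero_of_T hf (cokernel.desc f _ hκ)
    (by rw [← cancel_epi (cokernel.π f), cokernel.π_desc_assoc, Preadditive.sub_comp,
          Category.assoc, hσ]; simp)
    (by rw [← cancel_epi (cokernel.π f), cokernel.π_desc_assoc, Preadditive.sub_comp,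
          Category.assoc, hρ]; simp)
  refine Rel.of_hom (inv θ ≫ θ') ?_ ?_ hσ hρ
  · rw [← sub_eq_zero, ← cokernel.π_desc f _ hκ, hz, comp_zero]
  · rw [← h2]; simp [h2']

end

end Butterfly

/-- Diagrams up to isomorphism. -/
instance butterflySetoid (X Y : t.Tilt) : Setoid (Butterfly X Y) where
  r := Butterfly.Rel
  iseqv := ⟨Butterfly.Rel.refl, Butterfly.Rel.symm, Butterfly.Rel.trans⟩

/-- The category `B`: morphisms are isomorphism classes of diagrams. -/
noncomputable instance : Category t.Tilt where
  Hom X Y := Quotient (butterflySetoid X Y)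
  id _ := Quotient.mk _ (Butterfly.strict (𝟙 _) (𝟙 _) (by simp))
  comp := Quotient.map₂ Butterfly.comp fun _ _ h _ _ h' => Butterfly.comp_congr h h'
  id_comp := by rintro X Y ⟨P⟩; exact Quotient.sound (Butterfly.id_comp P)
  comp_id := by rintro X Y ⟨P⟩; exact Quotient.sound (Butterfly.comp_id P)
  assoc := by rintro X Y Z W ⟨P⟩ ⟨Q⟩ ⟨R⟩; exact Quotient.sound (Butterfly.comp_assoc P Q R)

/-- The morphism of `B` represented by a diagram. -/
def Butterfly.hom {X Y : t.Tilt} (P : Butterfly X Y) : X ⟶ Y := Quotient.mk _ P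

namespace Tilt

variable {X Y Z W : t.Tilt}

lemma exists_hom (f : X ⟶ Y) : ∃ P : Butterfly X Y, P.hom = f := Quotient.exists_rep f

lemma hom_eq_iff {P Q : Butterfly X Y} : P.hom = Q.hom ↔ P.Rel Q := Quotient.eq

lemma hom_comp_hom (P : Butterfly X Y) (Q : Butterfly Y Z) : P.hom ≫ Q.hom = (P.comp Q).hom := rfl

/-- The strict morphism of `B` given by a morphism of complexes `X ⟶ Y`. -/
noncomputable def ofChainMap (f : X.neg ⟶ Y.neg) (g : X.zer ⟶ Y.zer) (w : X.d ≫ g = f ≫ Y.d) :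
    X ⟶ Y :=
  (Butterfly.strict f g w).hom

lemma id_eq (X : t.Tilt) : 𝟙 X = ofChainMap (𝟙 _) (𝟙 _) (by simp) := rfl

/-- The zero morphisms of `B`. -/
noncomputable abbrev zeroMorphisms : HasZeroMorphisms t.Tilt where
  zero X Y := ⟨ofChainMap 0 0 (by simp)⟩
  comp_zero := by rintro X Y ⟨P⟩ Z; exact Quotient.sound (Butterfly.comp_zero_rel P)
  zero_comp := by rintro X Y Z ⟨Q⟩; exact Quotient.sound (Butterfly.zero_comp_rel Q)

section Abelian

attribute [local instance] zeroMorphisms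

lemma zero_eq : (0 : X ⟶ Y) = (Butterfly.strict 0 0 (by simp)).hom := rfl

/-- A two-term complex as an object of `B`. -/
abbrev of (t : TorsionPair A) {M N : A} (d : M ⟶ N)
    (h1 : ∀ ⦃S : A⦄, t.T S → ∀ g : S ⟶ M, g ≫ d = 0 → g = 0)
    (h2 : ∀ ⦃S : A⦄, t.F S → ∀ g : N ⟶ S, d ≫ g = 0 → g = 0) : t.Tilt where
  neg := M
  zer := N
  d := d
  ker_mem := (t.F_kernel_iff d).2 h1
  coker_mem := (t.T_cokernel_iff d).2 h2

lemma eq_zero_of_T (X : t.Tilt) {S : A} (hS : t.T S) (g : S ⟶ X.neg) (h : g ≫ X.d = 0) : g = 0 :=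
  (t.F_kernel_iff X.d).1 X.ker_mem hS g h

lemma eq_zero_of_F (X : t.Tilt) {S : A} (hS : t.F S) (g : X.zer ⟶ S) (h : X.d ≫ g = 0) : g = 0 :=
  (t.T_cokernel_iff X.d).1 X.coker_mem hS g h

/-- Kernel, cokernel and canonical factorization of a morphism of `B`. -/
lemma exists_factorization (f : X ⟶ Y) : ∃ (K I J C : t.Tilt) (i : K ⟶ X) (p : X ⟶ I) (m : I ⟶ J)
    (j : J ⟶ Y) (c : Y ⟶ C), IsIso m ∧ p ≫ m ≫ j = f ∧ Mono i ∧ Epi p ∧ Mono j ∧ Epi c ∧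
      i ≫ f = 0 ∧ f ≫ c = 0 ∧
      (∀ ⦃V : t.Tilt⦄ (g : V ⟶ X), g ≫ f = 0 → ∃ h, h ≫ i = g) ∧
      (∀ ⦃V : t.Tilt⦄ (g : X ⟶ V), i ≫ g = 0 → ∃ h, p ≫ h = g) ∧
      (∀ ⦃V : t.Tilt⦄ (g : V ⟶ Y), g ≫ c = 0 → ∃ h, h ≫ j = g) ∧
      (∀ ⦃V : t.Tilt⦄ (g : Y ⟶ V), f ≫ g = 0 → ∃ h, c ≫ h = g) := by
  obtain ⟨P, rfl⟩ := exists_hom f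
  obtain ⟨M, N, κ', a, b, r, hab, hκ, hρ, hS, hT, hF⟩ :=
    t.exists_torsion_factorization P.κ P.ρ P.κρ
  have hma : Mono a := hS.mono_f
  have heb : Epi b := hS.epi_g
  have hT' := (t.T_cokernel_iff _).1 hT
  have hF' := (t.F_kernel_iff _).1 hF
  have haρ : a ≫ P.ρ = 0 := by rw [← hρ, reassoc_of% hab, zero_comp]
  have hκb : P.κ ≫ b = 0 := by rw [← hκ, Category.assoc, hab, comp_zero]
  have hιr : P.ι ≫ b ≫ r = Y.d := by rw [hρ, P.ιρ]
  have hκσ : κ' ≫ a ≫ P.σ = X.d := by rw [reassoc_of% hκ, P.κσ]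
  -- the objects
  let K : t.Tilt := of t κ' (fun S hS g hg => by
      refine X.eq_zero_of_T hS g ?_
      rw [← P.κσ, ← hκ, Category.assoc, reassoc_of% hg, zero_comp]) hT'
  let C : t.Tilt := of t r hF' (fun S hS g hg => by
      refine Y.eq_zero_of_F hS g ?_
      rw [← P.ιρ, ← hρ]; simp [hg])
  let I : t.Tilt := of t (a ≫ P.σ) (fun S hS g hg => by
      rw [← cancel_mono a, zero_comp]
      exact P.eq_zero_of_T hS _ (by simpa using hg) (by simp [haρ])) (fun S hS g hg => by
      refine X.eq_zero_of_F hS g ?_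
      simp only [Category.assoc] at hg
      rw [← hκσ, Category.assoc, Category.assoc, hg, comp_zero])
  let J : t.Tilt := of t (P.ι ≫ b) (fun S hS g hg => by
      refine Y.eq_zero_of_T hS g ?_
      have := hg =≫ r
      simpa [hρ] using this) (fun S hS g hg => by
      rw [← cancel_epi b, comp_zero]
      exact P.eq_zero_of_F hS _ (by simp [reassoc_of% hκb]) (by simpa using hg))
  -- the morphisms
  let i : K ⟶ X := ofChainMap (X := K) (𝟙 X.neg) (a ≫ P.σ) (by simp [K, of, hκσ])
  let p : X ⟶ I := ofChainMap (Y := I) κ' (𝟙 X.zer) (by simp [I, of, hκσ])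
  let j : J ⟶ Y := ofChainMap (X := J) (𝟙 Y.neg) r (by simp [J, of, hιr])
  let c : Y ⟶ C := ofChainMap (Y := C) (P.ι ≫ b) (𝟙 Y.zer) (by simp [C, of, hιr])
  let mB : Butterfly I J :=
    { E := P.E, κ := a, ι := P.ι, σ := P.σ, ρ := b, κσ := rfl, ιρ := rfl, κρ := hab, ισ := P.ισ
      shortExact := P.shortExact }
  let mB' : Butterfly J I :=
    { E := P.E, κ := P.ι, ι := a, σ := b, ρ := P.σ, κσ := rfl, ιρ := rfl, κρ := P.ισ, ισ := hab
      shortExact := hS }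
  have hm : IsIso mB.hom := by
    refine ⟨mB'.hom, ?_, ?_⟩
    · exact hom_eq_iff.2 (Butterfly.comp_flip mB mB' (Iso.refl _) (by simp [mB, mB'])
        (by simp [mB, mB']) (by simp [mB, mB']) (by simp [mB, mB']))
    · exact hom_eq_iff.2 (Butterfly.comp_flip mB' mB (Iso.refl _) (by simp [mB, mB'])
        (by simp [mB, mB']) (by simp [mB, mB']) (by simp [mB, mB']))
  let pB : Butterfly X J :=
    { E := P.E, κ := P.κ, ι := P.ι, σ := P.σ, ρ := b, κσ := P.κσ, ιρ := rfl, κρ := hκb, ισ := P.ισ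
      shortExact := P.shortExact }
  have h1 : p ≫ mB.hom = pB.hom :=
    hom_eq_iff.2 ((Butterfly.strict_comp_iff _ _ _ _ _).2
      ⟨𝟙 P.E, by simp [pB, mB, hκ], by simp [pB, mB], by simp [pB, mB], by simp [pB, mB]⟩)
  have h2 : pB.hom ≫ j = P.hom :=
    hom_eq_iff.2 ((Butterfly.comp_strict_iff _ _ _ _ _).2
      ⟨𝟙 P.E, by simp [pB], (Category.comp_id _).trans (Category.id_comp _).symm, by simp [pB],
        by simp [pB, hρ]⟩)
  have hi : Mono i := ⟨by
    rintro V ⟨G⟩ ⟨G'⟩ h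
    exact Quotient.sound (Butterfly.rel_of_comp_strict _ _ _ (inferInstanceAs (IsIso (𝟙 X.neg)))
      I.ker_mem _ _ (Quotient.exact h))⟩
  have hj : Mono j := ⟨by
    rintro V ⟨G⟩ ⟨G'⟩ h
    exact Quotient.sound (Butterfly.rel_of_comp_strict _ _ _ (inferInstanceAs (IsIso (𝟙 Y.neg)))
      C.ker_mem _ _ (Quotient.exact h))⟩
  have hp : Epi p := ⟨by
    rintro V ⟨G⟩ ⟨G'⟩ h
    exact Quotient.sound (Butterfly.rel_of_strict_comp _ _ _ K.coker_mem
      (inferInstanceAs (IsIso (𝟙 X.zer))) _ _ (Quotient.exact h))⟩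
  have hc : Epi c := ⟨by
    rintro V ⟨G⟩ ⟨G'⟩ h
    exact Quotient.sound (Butterfly.rel_of_strict_comp _ _ _ J.coker_mem
      (inferInstanceAs (IsIso (𝟙 Y.zer))) _ _ (Quotient.exact h))⟩
  refine ⟨K, I, J, C, i, p, mB.hom, j, c, hm, ?_, hi, hp, hj, hc, ?_, ?_, ?_, ?_, ?_, ?_⟩
  · rw [← Category.assoc, h1, h2]
  · refine hom_eq_iff.2 ((Butterfly.comp_zero_iff _ _).2
      ⟨(Butterfly.strict (X := K) _ _ _).σ ≫ a + Butterfly.strictSnd (X := K) _ _ _ ≫ P.κ,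
        ?_, ?_, ?_, ?_⟩)
    · simp [K, of, hκ]
    · simp
    · simp [Butterfly.strict_ρ]
    · simp [haρ]
  · refine hom_eq_iff.2 ((Butterfly.comp_zero_iff _ _).2
      ⟨P.ρ ≫ Butterfly.strictInl (Y := C) _ _ _ - b ≫ (Butterfly.strict (Y := C) _ _ _).ι,
        ?_, ?_, ?_, ?_⟩)
    · simp [reassoc_of% hκb]
    · apply Butterfly.strict_ext
      · simp
      · simp only [Preadditive.comp_sub, Preadditive.sub_comp, Category.assoc,
          Butterfly.strictInl_snd, Butterfly.strict_ι_snd, Butterfly.strict_κ_snd, comp_zero,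
          zero_sub, neg_inj]
        exact congrArg (P.ι ≫ ·) (Category.comp_id b)
    · simp
    · simp [C, of, hρ]
  · intro V g hg
    obtain ⟨G, rfl⟩ := exists_hom g
    obtain ⟨θ, hθ1, hθ2, hθ3, hθ4⟩ := (Butterfly.comp_zero_iff _ _).1 (hom_eq_iff.1 hg)
    have hr : (θ ≫ b) ≫ r = 0 := by rw [Category.assoc, hρ, hθ4]
    have hz := G.eq_zero_of_F hF (kernel.lift r (θ ≫ b) hr)
      (by rw [← cancel_mono (kernel.ι r)]; simp [reassoc_of% hθ1])
      (by rw [← cancel_mono (kernel.ι r)]; simp [reassoc_of% hθ2, hκb])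
    have hθb : θ ≫ b = 0 := by rw [← kernel.lift_ι r (θ ≫ b) hr, hz, zero_comp]
    obtain ⟨l, hl⟩ : ∃ l, l ≫ a = θ := ⟨hS.exact.lift θ hθb, hS.exact.lift_f θ hθb⟩
    let H : Butterfly V K :=
      { E := G.E, κ := G.κ, ι := G.ι, σ := G.σ, ρ := l, κσ := G.κσ, ισ := G.ισ
        ιρ := by rw [← cancel_mono a, Category.assoc, hl, hθ2]; exact hκ.symm
        κρ := by rw [← cancel_mono a, Category.assoc, hl, hθ1, zero_comp]
        shortExact := G.shortExact }
    refine ⟨H.hom, hom_eq_iff.2 ((Butterfly.comp_strict_iff _ _ _ _ _).2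
      ⟨𝟙 G.E, by simp [H], (Category.comp_id _).trans (Category.id_comp _).symm, by simp [H], ?_⟩)⟩
    simp [H, reassoc_of% hl, hθ3]
  · intro V g hg
    obtain ⟨Q, rfl⟩ := exists_hom g
    obtain ⟨θ, hθ1, hθ2, hθ3, hθ4⟩ :=
      (Butterfly.strict_comp_iff _ _ _ _ _).1 (hom_eq_iff.1 hg)
    let α : M ⟶ Q.E := Butterfly.strictInl (X := K) (Y := V) _ _ _ ≫ θ
    have hα1 : κ' ≫ α = Q.κ := by
      have : (Butterfly.strict (X := K) (Y := V) 0 0 (by simp)).κ =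
          κ' ≫ Butterfly.strictInl (X := K) _ _ _ := by
        apply Butterfly.strict_ext <;> simp [K, of]
      rw [this, Category.assoc] at hθ1
      exact hθ1.trans (Category.id_comp _)
    let H : Butterfly I V :=
      { E := Q.E, κ := α, ι := Q.ι, σ := Q.σ, ρ := Q.ρ
        κσ := by simp [α, hθ3, I, of]
        ιρ := Q.ιρ
        κρ := by simp [α, hθ4]
        ισ := Q.ισ
        shortExact := Q.shortExact }
    exact ⟨H.hom, hom_eq_iff.2 ((Butterfly.strict_comp_iff _ _ _ _ _).2
      ⟨𝟙 Q.E, by simp [H, hα1], by simp [H], by simp [H], by simp [H]⟩)⟩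
  · intro V g hg
    obtain ⟨G, rfl⟩ := exists_hom g
    obtain ⟨θ, hθ1, hθ2, hθ3, hθ4⟩ :=
      (Butterfly.comp_strict_iff _ _ _ _ _).1 (hom_eq_iff.1 hg)
    let l : G.E ⟶ N := θ ≫ Butterfly.strictSnd (X := V) (Y := C) _ _ _
    let H : Butterfly V J :=
      { E := G.E, κ := G.κ, ι := G.ι, σ := G.σ, ρ := l, κσ := G.κσ, ισ := G.ισ
        ιρ := by simp [l, reassoc_of% hθ2, J, of]
        κρ := by simp [l, reassoc_of% hθ1]
        shortExact := G.shortExact }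
    refine ⟨H.hom, hom_eq_iff.2 ((Butterfly.comp_strict_iff _ _ _ _ _).2
      ⟨𝟙 G.E, by simp [H], (Category.comp_id _).trans (Category.id_comp _).symm, by simp [H], ?_⟩)⟩
    simpa [Butterfly.strict_ρ, H, l, C, of] using hθ4.symm
  · intro V g hg
    obtain ⟨Q, rfl⟩ := exists_hom g
    obtain ⟨θ, hθ1, hθ2, hθ3, hθ4⟩ := (Butterfly.comp_zero_iff _ _).1 (hom_eq_iff.1 hg)
    have hk : κ' ≫ a ≫ θ = 0 := by rw [reassoc_of% hκ, hθ1]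
    have hz := Q.eq_zero_of_T hT (cokernel.desc κ' (a ≫ θ) hk)
      (by rw [← cancel_epi (cokernel.π κ'), cokernel.π_desc_assoc]; simp [hθ3, haρ])
      (by rw [← cancel_epi (cokernel.π κ'), cokernel.π_desc_assoc]; simp [hθ4])
    have haθ : a ≫ θ = 0 := by rw [← cokernel.π_desc κ' (a ≫ θ) hk, hz, comp_zero]
    obtain ⟨l, hl⟩ : ∃ l, b ≫ l = θ := ⟨hS.exact.desc θ haθ, hS.exact.g_desc θ haθ⟩
    let H : Butterfly C V :=
      { E := Q.E, κ := l, ι := Q.ι, σ := Q.σ, ρ := Q.ρ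
        κσ := by rw [← cancel_epi b, reassoc_of% hl, hθ3]; exact hρ.symm
        ιρ := Q.ιρ
        κρ := by rw [← cancel_epi b, reassoc_of% hl, hθ4, comp_zero]
        ισ := Q.ισ
        shortExact := Q.shortExact }
    refine ⟨H.hom, hom_eq_iff.2 ((Butterfly.strict_comp_iff _ _ _ _ _).2
      ⟨𝟙 Q.E, ?_, by simp [H], by simp [H], by simp [H]⟩)⟩
    simp [H, hl, hθ2]

lemma hasZeroObject : HasZeroObject t.Tilt := by
  obtain ⟨z, hz⟩ := HasZeroObject.zero (C := A)
  let Z : t.Tilt := of t (0 : z ⟶ z) (fun _ _ g _ => hz.eq_of_tgt g 0)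
    (fun _ _ g _ => hz.eq_of_src g 0)
  refine ⟨Z, (IsZero.iff_id_eq_zero Z).2 ?_⟩
  have h1 : 𝟙 Z.neg = 0 := hz.eq_of_src _ _
  have h2 : 𝟙 Z.zer = 0 := hz.eq_of_src _ _
  rw [id_eq, zero_eq]
  simp only [h1, h2]
  rfl

lemma hasKernels : HasKernels t.Tilt where
  has_limit f := by
    obtain ⟨K, I, J, C, i, p, m, j, c, hm, h1, hi, hp, hj, hc, h2, h3, h4, h5, h6, h7⟩ :=
      exists_factorization f
    exact ⟨⟨⟨_, KernelFork.IsLimit.ofι i h2 (fun g hg => (h4 g hg).choose)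
      (fun g hg => (h4 g hg).choose_spec)
      (fun g hg l hl => by rw [← cancel_mono i, hl, (h4 g hg).choose_spec])⟩⟩⟩

lemma hasCokernels : HasCokernels t.Tilt where
  has_colimit f := by
    obtain ⟨K, I, J, C, i, p, m, j, c, hm, h1, hi, hp, hj, hc, h2, h3, h4, h5, h6, h7⟩ :=
      exists_factorization f
    exact ⟨⟨⟨_, CokernelCofork.IsColimit.ofπ c h3 (fun g hg => (h7 g hg).choose)
      (fun g hg => (h7 g hg).choose_spec)
      (fun g hg l hl => by rw [← cancel_epi c, hl, (h7 g hg).choose_spec])⟩⟩⟩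

lemma isNormalMonoCategory : IsNormalMonoCategory t.Tilt where
  normalMonoOfMono f hf := by
    obtain ⟨K, I, J, C, i, p, m, j, c, hm, h1, hi, hp, hj, hc, h2, h3, h4, h5, h6, h7⟩ :=
      exists_factorization f
    have hi0 : i = 0 := by rw [← cancel_mono f, h2, zero_comp]
    obtain ⟨s, hs⟩ := h5 (𝟙 _) (by rw [hi0, zero_comp])
    have : IsSplitMono p := ⟨⟨⟨s, hs⟩⟩⟩
    have : IsIso p := isIso_of_epi_of_isSplitMono p
    have h {V : t.Tilt} (g : V ⟶ _) (hg : g ≫ c = 0) :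
        ((h6 g hg).choose ≫ inv m ≫ inv p) ≫ f = g := by
      rw [← h1]; simpa using (h6 g hg).choose_spec
    exact ⟨{
      Z := C
      g := c
      w := h3
      isLimit := KernelFork.IsLimit.ofι f h3
        (fun g hg => (h6 g hg).choose ≫ inv m ≫ inv p) (fun g hg => h g hg)
        (fun g hg l hl => by rw [← cancel_mono f, hl, h g hg]) }⟩

lemma isNormalEpiCategory : IsNormalEpiCategory t.Tilt where
  normalEpiOfEpi f hf := by
    obtain ⟨K, I, J, C, i, p, m, j, c, hm, h1, hi, hp, hj, hc, h2, h3, h4, h5, h6, h7⟩ :=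
      exists_factorization f
    have hc0 : c = 0 := by rw [← cancel_epi f, h3, comp_zero]
    obtain ⟨s, hs⟩ := h6 (𝟙 _) (by rw [hc0, comp_zero])
    have : IsSplitEpi j := ⟨⟨⟨s, hs⟩⟩⟩
    have : IsIso j := isIso_of_mono_of_isSplitEpi j
    have h {V : t.Tilt} (g : _ ⟶ V) (hg : i ≫ g = 0) :
        f ≫ inv j ≫ inv m ≫ (h5 g hg).choose = g := by
      rw [← h1]; simpa using (h5 g hg).choose_spec
    exact ⟨{
      W := K
      g := i
      w := h2
      isColimit := CokernelCofork.IsColimit.ofπ f h2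
        (fun g hg => inv j ≫ inv m ≫ (h5 g hg).choose) (fun g hg => h g hg)
        (fun g hg l hl => by rw [← cancel_epi f, hl, h g hg]) }⟩

/-- The direct sum of two objects of `B`. -/
noncomputable abbrev sum (X Y : t.Tilt) : t.Tilt :=
  of t (biprod.map X.d Y.d)
    (fun S hS g hg => by
      apply biprod.hom_ext
      · rw [zero_comp]
        exact X.eq_zero_of_T hS _ (by simpa using hg =≫ biprod.fst)
      · rw [zero_comp]
        exact Y.eq_zero_of_T hS _ (by simpa using hg =≫ biprod.snd))
    (fun S hS g hg => by
      apply biprod.hom_ext'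
      · rw [comp_zero]
        exact X.eq_zero_of_F hS _ (by simpa using biprod.inl ≫= hg)
      · rw [comp_zero]
        exact Y.eq_zero_of_F hS _ (by simpa using biprod.inr ≫= hg))

lemma hasBinaryProducts : HasBinaryProducts t.Tilt := by
  have key (X Y : t.Tilt) : HasLimit (pair X Y) := by
    let p₁ : sum X Y ⟶ X := ofChainMap (X := sum X Y) biprod.fst biprod.fst (by simp [sum, of])
    let p₂ : sum X Y ⟶ Y := ofChainMap (X := sum X Y) biprod.snd biprod.snd (by simp [sum, of])
    have ex {W : t.Tilt} (f : W ⟶ X) (g : W ⟶ Y) : ∃ h : W ⟶ sum X Y,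
        (h ≫ p₁ = f ∧ h ≫ p₂ = g) ∧ ∀ h', h' ≫ p₁ = f → h' ≫ p₂ = g → h' = h := by
      obtain ⟨P, rfl⟩ := exists_hom f
      obtain ⟨Q, rfl⟩ := exists_hom g
      let R : Butterfly W (sum X Y) :=
        { E := pullback P.σ Q.σ
          κ := pullback.lift P.κ Q.κ (by simp)
          ι := biprod.desc (pullback.lift P.ι 0 (by simp)) (pullback.lift 0 Q.ι (by simp))
          σ := pullback.fst _ _ ≫ P.σ
          ρ := biprod.lift (pullback.fst _ _ ≫ P.ρ) (pullback.snd _ _ ≫ Q.ρ)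
          κσ := by simp
          ιρ := by
            apply biprod.hom_ext <;> apply biprod.hom_ext' <;> simp [sum, of]
          κρ := by apply biprod.hom_ext <;> simp
          ισ := by apply biprod.hom_ext' <;> simp
          shortExact := by
            refine Butterfly.shortExact_mk _ _ _ ?_ inferInstance ?_
            · refine Preadditive.mono_of_cancel_zero _ fun {S} z hz => ?_
              have hz1 := hz =≫ pullback.fst _ _
              have hz2 := hz =≫ pullback.snd _ _
              have e : z = (z ≫ biprod.fst) ≫ biprod.inl + (z ≫ biprod.snd) ≫ biprod.inr := by
                apply biprod.hom_ext <;> simp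
              rw [e] at hz1 hz2
              apply biprod.hom_ext
              · rw [← cancel_mono P.ι]; simpa using hz1
              · rw [← cancel_mono Q.ι]; simpa using hz2
            · intro S x hx
              obtain ⟨y, hy⟩ := P.exists_lift (x ≫ pullback.fst _ _) (by simpa using hx)
              obtain ⟨z, hz⟩ := Q.exists_lift (x ≫ pullback.snd _ _)
                (by rw [Category.assoc, ← pullback.condition]; exact hx)
              refine ⟨S, 𝟙 S, inferInstance, biprod.lift y z, ?_⟩
              apply pullback.hom_ext <;> simp [hy, hz, biprod.lift_desc] }
      have hR1 : R.hom ≫ p₁ = P.hom :=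
        hom_eq_iff.2 ((Butterfly.comp_strict_iff _ _ _ _ _).2 ⟨pullback.fst _ _, by simp [R],
          by apply biprod.hom_ext' <;> simp [R], by simp [R], by simp [R]⟩)
      have hR2 : R.hom ≫ p₂ = Q.hom :=
        hom_eq_iff.2 ((Butterfly.comp_strict_iff _ _ _ _ _).2 ⟨pullback.snd _ _, by simp [R],
          by apply biprod.hom_ext' <;> simp [R], by simp [R, pullback.condition], by simp [R]⟩)
      refine ⟨R.hom, ⟨hR1, hR2⟩, fun h' h1 h2 => ?_⟩
      obtain ⟨S, rfl⟩ := exists_hom h'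
      obtain ⟨θ, a1, a2, a3, a4⟩ := (Butterfly.comp_strict_iff _ _ _ _ _).1 (hom_eq_iff.1 h1)
      obtain ⟨η, b1, b2, b3, b4⟩ := (Butterfly.comp_strict_iff _ _ _ _ _).1 (hom_eq_iff.1 h2)
      refine hom_eq_iff.2 (Butterfly.Rel.of_hom (P := S) (Q := R)
        (pullback.lift θ η (by rw [a3, b3])) ?_ ?_ ?_ ?_)
      · apply pullback.hom_ext <;> simp [R, a1, b1]
      · apply pullback.hom_ext <;> apply biprod.hom_ext' <;> simp [R, a2, b2]
      · simp [R, a3]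
      · apply biprod.hom_ext <;> simp [R, a4, b4]
    exact ⟨⟨⟨BinaryFan.mk p₁ p₂, BinaryFan.IsLimit.mk _ (fun f g => (ex f g).choose)
      (fun f g => (ex f g).choose_spec.1.1) (fun f g => (ex f g).choose_spec.1.2)
      (fun f g m h1 h2 => (ex f g).choose_spec.2 m h1 h2)⟩⟩⟩
  exact hasBinaryProducts_of_hasLimit_pair _

lemma hasBinaryCoproducts : HasBinaryCoproducts t.Tilt := by
  have key (X Y : t.Tilt) : HasColimit (pair X Y) := by
    let i₁ : X ⟶ sum X Y := ofChainMap (Y := sum X Y) biprod.inl biprod.inl (by simp [sum, of])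
    let i₂ : Y ⟶ sum X Y := ofChainMap (Y := sum X Y) biprod.inr biprod.inr (by simp [sum, of])
    have ex {W : t.Tilt} (f : X ⟶ W) (g : Y ⟶ W) : ∃ h : sum X Y ⟶ W,
        (i₁ ≫ h = f ∧ i₂ ≫ h = g) ∧ ∀ h', i₁ ≫ h' = f → i₂ ≫ h' = g → h' = h := by
      obtain ⟨P, rfl⟩ := exists_hom f
      obtain ⟨Q, rfl⟩ := exists_hom g
      let R : Butterfly (sum X Y) W :=
        { E := pushout P.ι Q.ι
          κ := biprod.desc (P.κ ≫ pushout.inl _ _) (Q.κ ≫ pushout.inr _ _)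
          ι := P.ι ≫ pushout.inl _ _
          σ := biprod.lift (pushout.desc P.σ 0 (by simp)) (pushout.desc 0 Q.σ (by simp))
          ρ := pushout.desc P.ρ Q.ρ (by simp)
          κσ := by
            apply biprod.hom_ext <;> apply biprod.hom_ext' <;> simp [sum, of]
          ιρ := by simp
          κρ := by apply biprod.hom_ext' <;> simp
          ισ := by apply biprod.hom_ext <;> simp
          shortExact := by
            refine Butterfly.shortExact_mk _ _ _ inferInstance ?_ ?_
            · refine Preadditive.epi_of_cancel_zero _ fun {S} z hz => ?_
              have hz1 := pushout.inl _ _ ≫= hz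
              have hz2 := pushout.inr _ _ ≫= hz
              have e : z = biprod.fst ≫ biprod.inl ≫ z + biprod.snd ≫ biprod.inr ≫ z := by
                apply biprod.hom_ext' <;> simp
              rw [e] at hz1 hz2
              apply biprod.hom_ext'
              · rw [← cancel_epi P.σ]; simpa using hz1
              · rw [← cancel_epi Q.σ]; simpa using hz2
            · intro S x hx
              have : Epi (biprod.desc (pushout.inl P.ι Q.ι) (pushout.inr P.ι Q.ι)) := by
                refine Preadditive.epi_of_cancel_zero _ fun {S} z hz => ?_
                apply pushout.hom_ext
                · simpa using biprod.inl ≫= hz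
                · simpa using biprod.inr ≫= hz
              obtain ⟨S', π, hπ, y, hy⟩ := surjective_up_to_refinements_of_epi
                (biprod.desc (pushout.inl P.ι Q.ι) (pushout.inr P.ι Q.ι)) x
              have e : y = (y ≫ biprod.fst) ≫ biprod.inl + (y ≫ biprod.snd) ≫ biprod.inr := by
                apply biprod.hom_ext <;> simp
              have hx' := hy =≫ biprod.lift (pushout.desc P.σ 0 (by simp))
                (pushout.desc (f := P.ι) 0 Q.σ (by simp))
              rw [Category.assoc, hx, comp_zero, e] at hx'
              obtain ⟨z, hz⟩ := P.exists_lift (y ≫ biprod.fst)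
                (by simpa using (hx' =≫ biprod.fst).symm)
              obtain ⟨z', hz'⟩ := Q.exists_lift (y ≫ biprod.snd)
                (by simpa using (hx' =≫ biprod.snd).symm)
              refine ⟨S', π, hπ, z + z', ?_⟩
              rw [hy, e, ← hz, ← hz', Preadditive.add_comp]
              simp [pushout.condition] }
      have hR1 : i₁ ≫ R.hom = P.hom :=
        hom_eq_iff.2 ((Butterfly.strict_comp_iff _ _ _ _ _).2 ⟨pushout.inl _ _, by simp [R],
          by simp [R], by apply biprod.hom_ext <;> simp [R], by simp [R]⟩)
      have hR2 : i₂ ≫ R.hom = Q.hom :=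
        hom_eq_iff.2 ((Butterfly.strict_comp_iff _ _ _ _ _).2 ⟨pushout.inr _ _, by simp [R],
          by simp [R, pushout.condition], by apply biprod.hom_ext <;> simp [R], by simp [R]⟩)
      refine ⟨R.hom, ⟨hR1, hR2⟩, fun h' h1 h2 => ?_⟩
      obtain ⟨S, rfl⟩ := exists_hom h'
      obtain ⟨θ, a1, a2, a3, a4⟩ := (Butterfly.strict_comp_iff _ _ _ _ _).1 (hom_eq_iff.1 h1)
      obtain ⟨η, b1, b2, b3, b4⟩ := (Butterfly.strict_comp_iff _ _ _ _ _).1 (hom_eq_iff.1 h2)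
      refine (hom_eq_iff.2 (Butterfly.Rel.of_hom (P := R) (Q := S)
        (pushout.desc θ η (by rw [a2, b2])) ?_ ?_ ?_ ?_)).symm
      · apply biprod.hom_ext' <;> simp [R, a1, b1]
      · simp [R, a2]
      · apply pushout.hom_ext <;> apply biprod.hom_ext <;> simp [R, a3, b3]
      · apply pushout.hom_ext <;> simp [R, a4, b4]
    exact ⟨⟨⟨BinaryCofan.mk i₁ i₂, BinaryCofan.IsColimit.mk _ (fun f g => (ex f g).choose)
      (fun f g => (ex f g).choose_spec.1.1) (fun f g => (ex f g).choose_spec.1.2)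
      (fun f g m h1 h2 => (ex f g).choose_spec.2 m h1 h2)⟩⟩⟩
  exact hasBinaryCoproducts_of_hasColimit_pair _

/-- `B` has all the structure that makes a category abelian, apart from the (unique) addition
of morphisms. -/
noncomputable abbrev nonPreadditiveAbelian : NonPreadditiveAbelian t.Tilt :=
  have := hasZeroObject (t := t)
  have := hasBinaryProducts (t := t)
  have := hasBinaryCoproducts (t := t)
  have : HasTerminal t.Tilt := HasZeroObject.hasTerminal
  have : HasInitial t.Tilt := HasZeroObject.hasInitial
  { toHasZeroMorphisms := zeroMorphisms
    toIsNormalMonoCategory := isNormalMonoCategory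
    toIsNormalEpiCategory := isNormalEpiCategory
    has_zero_object := hasZeroObject
    has_kernels := hasKernels
    has_cokernels := hasCokernels
    has_finite_products := hasFiniteProducts_of_has_binary_and_terminal
    has_finite_coproducts := hasFiniteCoproducts_of_has_binary_and_initial }

end Abelian

/-- `B` is an abelian category. The additive structure is the one forced by the finite products
and coproducts: an abelian category has exactly one. -/
noncomputable instance abelian : Abelian t.Tilt :=
  letI := nonPreadditiveAbelian (t := t)
  NonPreadditiveAbelian.abelian _

variable (t) in
/-- The strict morphisms of `B`: those that come from morphisms of complexes. -/
def strict : MorphismProperty t.Tilt :=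
  fun X Y φ => ∃ (f : X.neg ⟶ Y.neg) (g : X.zer ⟶ Y.zer) (w : X.d ≫ g = f ≫ Y.d),
    φ = ofChainMap f g w

instance : (strict t).IsMultiplicative where
  id_mem X := ⟨𝟙 _, 𝟙 _, by simp, rfl⟩
  comp_mem := by
    rintro X Y Z _ _ ⟨f, g, w, rfl⟩ ⟨f', g', w', rfl⟩
    exact ⟨f ≫ f', g ≫ g', by simp [reassoc_of% w, w'],
      Quotient.sound (Butterfly.strict_comp_strict _ _ _ _ _ _ _)⟩

end Tilt

variable (t)

/-- The category `Ch(B)` of unbounded complexes in `B`. -/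
abbrev Ch : Type _ := CochainComplex t.Tilt ℤ

/-- The morphisms of complexes in `B` all of whose components are strict. -/
def strictCh : MorphismProperty t.Ch :=
  fun _ _ φ => ∀ n : ℤ, Tilt.strict t (φ.f n)

instance : (strictCh t).IsMultiplicative where
  id_mem X n := (Tilt.strict t).id_mem (X.X n)
  comp_mem φ ψ hφ hψ n := (Tilt.strict t).comp_mem (φ.f n) (ψ.f n) (hφ n) (hψ n)

/-- The category `Ch^st(B)`: all complexes in `B`, and strict morphisms of complexes. -/
abbrev ChSt : Type _ := WideSubcategory (strictCh t)

/-- The inclusion `Ch^st(B) ⥤ Ch(B)`. -/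
noncomputable abbrev chStInclusion : t.ChSt ⥤ t.Ch := wideSubcategoryInclusion (strictCh t)

/-- The strict morphisms of complexes that are isomorphisms in `Ch(B)`. -/
def sis : MorphismProperty t.ChSt := (MorphismProperty.isomorphisms t.Ch).inverseImage t.chStInclusion

/-- The strict morphisms of complexes that are quasi-isomorphisms. -/
def qis : MorphismProperty t.ChSt :=
  (HomologicalComplex.quasiIso t.Tilt (ComplexShape.up ℤ)).inverseImage t.chStInclusion

end TorsionPair

/-! ### Localizations detected by roofs -/

namespace CategoryTheory

/-! The point is that every morphism of $\mathsf{B}$ is a fraction of strict ones. A butterfly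
$(E,\kappa,\iota,\sigma,\rho)\colon\mathbb{X}\to\mathbb{Y}$ has an apex $[X^{-1}\oplus
Y^{-1}\xrightarrow{(\kappa,\iota)}E]$, again an object of $\mathsf{B}$, with two strict projections:
$(\mathrm{pr}_1,\sigma)$ to $\mathbb{X}$ and $(\mathrm{pr}_2,\rho)$ to $\mathbb{Y}$. The first is a
quasi-isomorphism of two-term complexes: it is surjective in both degrees and its kernel is
$[Y^{-1}\cong Y^{-1}]$. Hence it is invertible in $\mathsf{B}$, and the butterfly is its inverse
followed by the second projection (`apexSource_comp_hom`).

This passes to complexes with no coherence problem, because strictness is demanded only of the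
components of a morphism of complexes and never of the differentials. Given $f\colon X\to Y$ in
$\mathsf{Ch}(\mathsf{B})$, choose a butterfly for each $f^n$ independently and transport the
differential of $X$ along the invertible projections from the apexes. The result is a complex $Z$
with a strict isomorphism $p\colon Z\to X$ such that $fp$ is also strict (`exists_strictCh_roof`).

The inclusion $\mathsf{Ch}^{st}(\mathsf{B})\to\mathsf{Ch}(\mathsf{B})$ is faithful and bijective on
objects, so these roofs make it the localization at the morphisms it inverts
(`Functor.isLocalization_of_faithful_of_roof`). The derived statement follows by composing with the
localization $\mathsf{Ch}(\mathsf{B})\to\mathcal{D}(\mathsf{B})$: the roofs also show that each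
quasi-isomorphism is isomorphic, as an arrow, to a strict one (`quasiIso_le_map_qis`). -/

/-- A faithful, essentially surjective functor `F` such that every morphism between objects in
its image is of the form `F(p)⁻¹ ≫ F(q)` is the localization at the morphisms it inverts. -/
lemma Functor.isLocalization_of_faithful_of_roof {C D : Type*} [Category* C] [Category* D]
    (F : C ⥤ D) [F.Faithful] [F.EssSurj]
    (hF : ∀ ⦃X Y : C⦄ (φ : F.obj X ⟶ F.obj Y), ∃ (Z : C) (p : Z ⟶ X) (q : Z ⟶ Y),
      IsIso (F.map p) ∧ F.map p ≫ φ = F.map q) :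
    F.IsLocalization ((MorphismProperty.isomorphisms D).inverseImage F) := by
  let W := (MorphismProperty.isomorphisms D).inverseImage F
  have hW : W.IsInvertedBy F := fun _ _ _ h => h
  have : W.HasRightCalculusOfFractions :=
    -- The roof of $F(s)^{-1}F(f)$ completes the Ore square: it commutes after applying `F`, hence
    -- already in `C`.
    { exists_rightFraction := fun X Y φ => by
        have := hW _ φ.hs
        obtain ⟨Z, p, q, hp, hpq⟩ := hF (F.map φ.f ≫ CategoryTheory.inv (F.map φ.s))
        refine ⟨⟨p, hp, q⟩, F.map_injective ?_⟩
        simp [← hpq]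
      ext := fun X Y Y' f₁ f₂ s hs h => by
        have := hW _ hs
        -- Faithfulness makes every `s` in `W` right cancellable, so $f_1=f_2$ already and the
        -- equalizing denominator can be the identity.
        refine ⟨X, 𝟙 X, W.id_mem X, congrArg (𝟙 X ≫ ·) (F.map_injective ?_)⟩
        rw [← cancel_mono (F.map s), ← F.map_comp, ← F.map_comp, h] }
  let G := Localization.Construction.lift F hW
  let e : W.Q ⋙ G ≅ F := eqToIso (Localization.Construction.fac F hW)
  have hobj (X : W.Localization) : ∃ Y, W.Q.obj Y = X :=
    ⟨_, (Localization.Construction.objEquiv W).apply_symm_apply X⟩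
  have hmap {X Y : C} (f : X ⟶ Y) : G.map (W.Q.map f) = F.map f := by
    -- The objects on both sides agree definitionally, so the two transports in `congr_hom` are
    -- identities.
    refine (Functor.congr_hom (Localization.Construction.fac F hW) f).trans ?_
    exact (Category.id_comp _).trans (Category.comp_id _)
  have hroof {X Y : C} (a : W.Q.obj X ⟶ W.Q.obj Y) : ∃ (Z : C) (s : Z ⟶ X) (f : Z ⟶ Y),
      W s ∧ W.Q.map s ≫ a = W.Q.map f := by
    obtain ⟨φ, rfl⟩ := Localization.exists_rightFraction W.Q W a
    exact ⟨_, φ.s, φ.f, φ.hs, φ.map_s_comp_map _ _⟩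
  have : G.Faithful := ⟨by
    intro X Y a b hab
    obtain ⟨X, rfl⟩ := hobj X
    obtain ⟨Y, rfl⟩ := hobj Y
    obtain ⟨Z, s, f, hs, hf⟩ := hroof a
    obtain ⟨Z', s', f', hs', hf'⟩ := hroof b
    -- The Ore condition for the cospan `s`, `s'` brings both roofs to the common denominator `ψ.s ≫
    -- s`. Their numerators then have the same image under `F`, so they coincide in `C`.
    obtain ⟨ψ, hψ⟩ := (MorphismProperty.LeftFraction.mk s s' hs').exists_rightFraction
    dsimp only at hψ
    have ha : W.Q.map (ψ.s ≫ s) ≫ a = W.Q.map (ψ.s ≫ f) := by simp [hf]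
    have hb : W.Q.map (ψ.s ≫ s) ≫ b = W.Q.map (ψ.f ≫ f') := by simp [hψ, hf']
    have h : ψ.s ≫ f = ψ.f ≫ f' := F.map_injective (by
      rw [← hmap, ← hmap, ← ha, ← hb, G.map_comp, G.map_comp, hab])
    have := Localization.inverts W.Q W _ (W.comp_mem _ _ ψ.hs hs)
    rw [← cancel_epi (W.Q.map (ψ.s ≫ s)), ha, hb, h]⟩
  have : G.Full := ⟨by
    intro X Y φ
    -- Every object of the localization is `W.Q.obj X`, so `φ` is a morphism between values of `F`,
    -- and the hypothesis `hF` supplies its roof.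
    obtain ⟨X, rfl⟩ := hobj X
    obtain ⟨Y, rfl⟩ := hobj Y
    obtain ⟨Z, p, q, hp, hpq⟩ := hF (X := X) (Y := Y) φ
    have := Localization.inverts W.Q W p hp
    refine ⟨CategoryTheory.inv (W.Q.map p) ≫ W.Q.map q, ?_⟩
    rw [G.map_comp, G.map_inv, IsIso.inv_comp_eq]
    exact (hmap q).trans (hpq.symm.trans (congrArg (· ≫ φ) (hmap p).symm))⟩
  have : G.EssSurj := ⟨fun Y => ⟨W.Q.obj (F.objPreimage Y),
    ⟨e.app (F.objPreimage Y) ≪≫ F.objObjPreimageIso Y⟩⟩⟩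
  exact { inverts := hW, isEquivalence := { } }

end CategoryTheory

/-! ### Transport of a complex along degreewise isomorphisms -/

/-- Transport of a complex along isomorphisms of its objects. -/
def HomologicalComplex.ofIsos {ι C : Type*} [Category* C] [HasZeroMorphisms C]
    {c : ComplexShape ι} (K : HomologicalComplex C c) (X : ι → C) (e : ∀ i, X i ≅ K.X i) :
    HomologicalComplex C c where
  X := X
  d i j := (e i).hom ≫ K.d i j ≫ (e j).inv
  shape i j h := by simp [K.shape i j h]

/-- The transported complex is isomorphic to the original one. -/
def HomologicalComplex.ofIsosIso {ι C : Type*} [Category* C] [HasZeroMorphisms C]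
    {c : ComplexShape ι} (K : HomologicalComplex C c) (X : ι → C) (e : ∀ i, X i ≅ K.X i) :
    K.ofIsos X e ≅ K :=
  HomologicalComplex.Hom.isoOfComponents e (by intros; simp [ofIsos])

namespace TorsionPair

variable {A : Type u} [Category.{v} A] [Abelian A] {t : TorsionPair A}

/-! ### The apex of a butterfly and its strict projections -/

namespace Butterfly

variable {X Y : t.Tilt} (P : Butterfly X Y)

/-- The two-term complex `(κ, ι) : X⁻¹ ⊞ Y⁻¹ ⟶ E` of a diagram. -/
noncomputable abbrev apex : t.Tilt :=
  Tilt.of t (biprod.desc P.κ P.ι)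
    (fun S hS g hg => by
      have hg' : (g ≫ biprod.fst) ≫ P.κ + (g ≫ biprod.snd) ≫ P.ι = 0 := by
        simpa [biprod.desc_eq] using hg
      -- Composing with `σ` kills the summand through `ι` and turns `κ` into the differential of
      -- `X`, whose kernel is torsion-free. The other component then dies because `ι` is a
      -- monomorphism.
      have h1 : g ≫ biprod.fst = 0 := X.eq_zero_of_T hS _ (by
        simpa only [Preadditive.add_comp, Category.assoc, κσ, ισ, comp_zero, add_zero, zero_comp]
          using hg' =≫ P.σ)
      rw [h1, zero_comp, zero_add] at hg'
      have h2 : g ≫ biprod.snd = 0 := by rw [← cancel_mono P.ι, hg', zero_comp]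
      apply biprod.hom_ext
      · rw [h1, zero_comp]
      · rw [h2, zero_comp])
    -- A map from `E` that kills `ι` descends along `σ` to $X^0$. If it also kills `κ`, the
    -- descended map kills the differential of `X`, whose cokernel is torsion.
    (fun S hS g hg => P.eq_zero_of_F hS g (by simpa using biprod.inl ≫= hg)
      (by simpa using biprod.inr ≫= hg))

/-- The strict morphism from the apex of a diagram to its target. -/
noncomputable def apexTarget : P.apex ⟶ Y :=
  Tilt.ofChainMap (X := P.apex) biprod.snd P.ρ (by
    apply biprod.hom_ext' <;> simp [apex])

lemma apexSource_comm : P.apex.d ≫ P.σ = biprod.fst ≫ X.d := by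
  apply biprod.hom_ext' <;> simp [apex]

/-- The strict morphism from the apex of a diagram to its source. -/
noncomputable def apexSource : P.apex ⟶ X :=
  Tilt.ofChainMap (X := P.apex) biprod.fst P.σ P.apexSource_comm

lemma strict_apexTarget : Tilt.strict t P.apexTarget := ⟨_, _, _, rfl⟩

lemma strict_apexSource : Tilt.strict t P.apexSource := ⟨_, _, _, rfl⟩

/-- This is the fraction itself: once `apexSource` is inverted, the morphism of `P` becomes a
quotient of two strict morphisms. By `strict_comp_iff` it is enough to find one map from the middle
object $E\oplus Y^{-1}$ of the strict diagram of `apexTarget` to `E`. -/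
lemma apexSource_comp_hom : P.apexSource ≫ P.hom = P.apexTarget := by
  refine Tilt.hom_eq_iff.2 ((strict_comp_iff _ _ _ _ _).2
    -- The map is $(\mathrm{id}_E,\iota)$ on $E\oplus Y^{-1}$. The sign in the arrow `κ` of a strict
    -- diagram is what makes it compatible:
    -- $(\kappa,\iota)-\iota\,\mathrm{pr}_2=\kappa\,\mathrm{pr}_1$.
    ⟨(strict (X := P.apex) _ _ _).σ + strictSnd (X := P.apex) _ _ _ ≫ P.ι, ?_, ?_, ?_, ?_⟩)
  · apply biprod.hom_ext' <;> simp
  · simp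
  · simp
  · simp [strict_ρ]

/-- Up to signs this is the mapping cone of $(\mathrm{pr}_1,\sigma)$, which is acyclic because that
map is a quasi-isomorphism. It is also the diagonal `κ`, `ρ` of the strict diagram of `apexSource`,
and its exactness is what allows that diagram to be flipped. -/
lemma biprod_shortExact :
    (ShortComplex.mk (biprod.lift (biprod.desc P.κ P.ι) (-biprod.fst)) (biprod.desc P.σ X.d)
      (by apply biprod.hom_ext' <;> simp)).ShortExact := by
  refine shortExact_mk _ _ _ ?_ ?_ fun S x hx => ?_
  · refine Preadditive.mono_of_cancel_zero _ fun {S} z hz => ?_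
    have hz1 : z ≫ biprod.desc P.κ P.ι = 0 := by simpa using hz =≫ biprod.fst
    have hz2 : z ≫ biprod.fst = 0 := by simpa using hz =≫ biprod.snd
    have hz3 : z ≫ biprod.snd = 0 := by
      rw [← cancel_mono P.ι, zero_comp, ← hz1, biprod.desc_eq]
      simp [reassoc_of% hz2]
    apply biprod.hom_ext
    · rw [hz2, zero_comp]
    · rw [hz3, zero_comp]
  · have : Epi (biprod.inl ≫ biprod.desc P.σ X.d) := by
      rw [biprod.inl_desc]
      infer_instance
    exact epi_of_epi biprod.inl _
  · have hx' : (x ≫ biprod.fst) ≫ P.σ + (x ≫ biprod.snd) ≫ X.d = 0 := by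
      simpa [biprod.desc_eq] using hx
    -- For $(e,x)$ with $\sigma e+dx=0$, the element $e+\kappa x$ is killed by $\sigma$, hence
    -- equals $\iota y$. Then $(-x,y)$ maps to $(-\kappa x+\iota y,\,x)=(e,x)$.
    obtain ⟨y, hy⟩ := P.exists_lift (x ≫ biprod.fst + (x ≫ biprod.snd) ≫ P.κ)
      (by simpa using hx')
    refine ⟨S, 𝟙 S, inferInstance, biprod.lift (-(x ≫ biprod.snd)) y, ?_⟩
    apply biprod.hom_ext
    · simp [biprod.lift_desc, hy]
    · simp

/-- A butterfly whose two diagonals are both short exact is invertible, its inverse being the same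
diagram read in the opposite direction. The second diagonal here is `biprod_shortExact`. -/
instance : IsIso P.apexSource := by
  let R := strict (X := P.apex) biprod.fst P.σ P.apexSource_comm
  let R' := R.flip P.biprod_shortExact
  exact ⟨R'.hom,
    Tilt.hom_eq_iff.2 (comp_flip R R' (Iso.refl _) (by simp [R', flip]) (by simp [R', flip])
      (by simp [R', flip]) (by simp [R', flip])),
    Tilt.hom_eq_iff.2 (comp_flip R' R (Iso.refl _) (by simp [R', flip]) (by simp [R', flip])
      (by simp [R', flip]) (by simp [R', flip]))⟩

end Butterfly

/-! ### Strict roofs for morphisms of complexes -/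

/-- Every morphism of complexes in `B` is a fraction of strict morphisms of complexes. -/
lemma exists_strictCh_roof {X Y : t.Ch} (f : X ⟶ Y) :
    ∃ (Z : t.Ch) (p : Z ⟶ X) (q : Z ⟶ Y), strictCh t p ∧ strictCh t q ∧ IsIso p ∧ p ≫ f = q := by
  choose P hP using fun n => Tilt.exists_hom (f.f n)
  -- The representatives `P n` need not be compatible across degrees: the differential of `X` is
  -- conjugated by the isomorphisms from the apexes, and the resulting differential need not be
  -- strict.
  let e := X.ofIsosIso (fun n => (P n).apex) (fun n => asIso (P n).apexSource)
  refine ⟨_, e.hom, e.hom ≫ f, fun n => (P n).strict_apexSource, fun n => ?_, inferInstance, rfl⟩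
  have : (e.hom ≫ f).f n = (P n).apexTarget := by
    rw [HomologicalComplex.comp_f, ← hP]
    exact (P n).apexSource_comp_hom
  rw [this]
  exact (P n).strict_apexTarget

/-! ### The two localizations -/

variable (t)

instance : t.chStInclusion.EssSurj := ⟨fun X => ⟨⟨X⟩, ⟨Iso.refl X⟩⟩⟩

/-- By definition `sis` is the class of morphisms inverted by the inclusion, so the roof criterion
applies directly. -/
instance : t.chStInclusion.IsLocalization t.sis :=
  t.chStInclusion.isLocalization_of_faithful_of_roof fun X Y φ => by
    obtain ⟨Z, p, q, hp, hq, hi, h⟩ := exists_strictCh_roof (X := X.obj) (Y := Y.obj) φ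
    exact ⟨⟨Z⟩, ⟨p, hp⟩, ⟨q, hq⟩, hi, h⟩

/-- In a roof $q=\varphi p$ with $p$ invertible, $q$ is a quasi-isomorphism exactly when $\varphi$
is. Since `MorphismProperty.map` is closed under isomorphisms of arrows, the strict $q$ accounts for
$\varphi$. This is the hypothesis needed to compose the two localizations. -/
lemma quasiIso_le_map_qis :
    HomologicalComplex.quasiIso t.Tilt (ComplexShape.up ℤ) ≤ t.qis.map t.chStInclusion := by
  intro X Y φ hφ
  obtain ⟨Z, p, q, hp, hq, hi, h⟩ := exists_strictCh_roof φ
  let X' : t.ChSt := ⟨X⟩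
  let Y' : t.ChSt := ⟨Y⟩
  let Z' : t.ChSt := ⟨Z⟩
  let q' : Z' ⟶ Y' := ⟨q, hq⟩
  have hq' : t.qis q' := by
    change HomologicalComplex.quasiIso t.Tilt (ComplexShape.up ℤ) q
    rw [← h]
    exact (MorphismProperty.cancel_left_of_respectsIso _ p φ).2 hφ
  -- The pair `p`, `𝟙 Y` is an isomorphism from the arrow `q` to the arrow `φ`.
  refine (MorphismProperty.arrow_mk_iso_iff _ (Arrow.isoMk (asIso p) (Iso.refl Y) ?_)).1
    (MorphismProperty.map_mem_map _ t.chStInclusion q' hq')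
  exact h.trans (Category.comp_id q).symm

end TorsionPair

theorem propositionP {A : Type u} [Category.{v} A] [Abelian A] (t : TorsionPair A)
    [HasDerivedCategory.{w} t.Tilt] :
    (∃ h : t.sis.IsInvertedBy t.chStInclusion,
      (Localization.Construction.lift t.chStInclusion h).IsEquivalence) ∧
    (∃ h : t.qis.IsInvertedBy (t.chStInclusion ⋙ DerivedCategory.Q),
      (Localization.Construction.lift (t.chStInclusion ⋙ DerivedCategory.Q) h).IsEquivalence) := by
  have h : t.qis.IsInvertedBy (t.chStInclusion ⋙ DerivedCategory.Q) := fun _ _ f hf =>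
    Localization.inverts DerivedCategory.Q
      (HomologicalComplex.quasiIso t.Tilt (ComplexShape.up ℤ)) _ hf
  have : (t.chStInclusion ⋙ DerivedCategory.Q).IsLocalization t.qis :=
    -- A composite of localizations is the localization at `qis`, because `qis` is inverted by the
    -- composite, contains `sis` (isomorphisms are quasi-isomorphisms), and maps onto all
    -- quasi-isomorphisms up to isomorphism of arrows.
    Functor.IsLocalization.comp t.chStInclusion DerivedCategory.Q t.sis
      (HomologicalComplex.quasiIso t.Tilt (ComplexShape.up ℤ)) t.qis h
      (fun _ _ f hf => MorphismProperty.isomorphisms_le_of_containsIdentities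
        (HomologicalComplex.quasiIso t.Tilt (ComplexShape.up ℤ)) _ hf) t.quasiIso_le_map_qis
  exact ⟨⟨Localization.inverts t.chStInclusion t.sis, inferInstance⟩, h, inferInstance⟩
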